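/- A \emph{positive initial tree} is a finite syntactical tree of Independence-Friendly (IF) logic whose nodes are occurrences of the connectives $\land,\lor$ (each with at most two successors) and of slashed quantifiers $(Qv/V)$, $Q\in\{\forall,\exists\}$, with $V$ a finite set of variables (each with at most one successor). Write $m\prec_T n$ if the node $n$ of $T$ is properly subordinated to (below) the node $m$. The places where a successor is missing are the \emph{gaps} of $T$; each gap is the end of exactly one \emph{path} $R$ of $T$, and $Bound(R)$ is the set of variables quantified along $R$. The free variables of a tree are given by $FV((Qv/V)S)=(FV(S)\setminus\{v\})\cup V$ and $FV(S\circ S')=FV(S)\cup FV(S')$. The tree is \emph{regular} if no variable occurs in it both free and bound and no quantifier is subordinated to a quantifier of the same variable. In a tree, $(Qw/W)$ \emph{depends on} $(Q'v/V)$ if $(Q'v/V)\prec(Qw/W)$ and $v\notin W$. A \emph{weak, sentential completing function} for $T$, over a finite first-order vocabulary, assigns to each path $R$ of $T$ a quantifier-free formula $e(R)$ with $FV(e(R))\subseteq Bound(R)$; $\hat e(T)$ is the formula obtained by putting $e(R)$ into the gap at the end of $R$, for all $R$. Its model-checking problem is to decide, given a (string representing a) finite nonempty structure $M$, whether $M\models\hat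 e(T)$ in team semantics, i.e. whether $\{\emptyset\}$ satisfies $\hat e(T)$ in $M$. For $K\in\{\mathrm{NL},\mathrm P,\mathrm{NP}\}$, $T$ is \emph{$K$-hard} if for at least one weak, sentential completing function $e$, over some finite vocabulary, the model-checking problem for $\hat e(T)$ is $K$-hard under many-one reductions: logarithmic-space reductions for $\mathrm{NL}$ and $\mathrm P$, polynomial-time reductions for $\mathrm{NP}$. Let $T,U$ be positive initial trees. We say that $U$ \emph{extends} $T$ if there is an injective map $\mu$ from the nodes of $T$ to the nodes of $U$ such that 1. $\mu$ sends each quantifier $(Qv/V)$ to a quantifier $(Qv/V')$, for some slash set $V'$, and each connective to an occurrence of the same connective; 2. $\mu$ respects the tree ordering: $m\prec_T n$ implies $\mu(m)\prec_U\mu(n)$, and if $m$ and $n$ lie in different branches below a connective $c$ of $T$, then $\mu(m)$ and $\mu(n)$ lie in different branches below $\mu(c)$; 3. for all quantifiers $(Qv/V)$, $(Q'w/W)$ in $T$, the latter depends on the former in $T$ if and only if $\mu((Q'w/W))$ depends on $\mu((Qv/V))$ in $U$. **Lemma.** Let $U$ be a regular positive initial tree that extends a positive initial tree $T$. If $T$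 is $\mathrm{NL}$-hard, then $U$ is $\mathrm{NL}$-hard; if $T$ is $\mathrm{P}$-hard, then $U$ is $\mathrm{P}$-hard; if $T$ is $\mathrm{NP}$-hard, then $U$ is $\mathrm{NP}$-hard. -/

import Mathlib

namespace IFLogic

/-! ### Vocabularies and finite structures -/

/-- A finite first-order vocabulary, given by the lists of the arities of its function symbols
(constants are the function symbols of arity `0`) and of its relation symbols. -/
structure Vocabulary where
  funArity : List ℕ
  relArity : List ℕ

/-- The first-order language of a vocabulary: the `k`-ary symbols are the positions in the
corresponding list that hold the number `k`. -/
def Vocabulary.lang (τ : Vocabulary) : FirstOrder.Language.{0, 0} where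
  Functions k := {i : Fin τ.funArity.length // τ.funArity.get i = k}
  Relations k := {i : Fin τ.relArity.length // τ.relArity.get i = k}

/-! ### Formulas of Independence-Friendly logic -/

/-- The two quantifiers. -/
inductive Quantifier
  | all
  | ex

/-- The two binary connectives. -/
inductive Connective
  | and
  | or

/-- Formulas of Independence-Friendly logic over a first-order language, with variables in `ℕ`;
`quant q v V φ` is `(q v / V) φ`, the finite set `V` being the slash set of the quantifier. -/
inductive Formula (L : FirstOrder.Language.{0, 0}) : Type
  | equal (t u : L.Term ℕ) : Formula L
  | rel {k : ℕ} (R : L.Relations k) (ts : Fin k → L.Term ℕ) : Formula L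
  | neg (φ : Formula L) : Formula L
  | conn (c : Connective) (φ ψ : Formula L) : Formula L
  | quant (q : Quantifier) (v : ℕ) (V : Finset ℕ) (φ : Formula L) : Formula L

namespace Formula

variable {L : FirstOrder.Language.{0, 0}}

/-- The free variables of a formula; the variables of a slash set count as free at the
quantifier that carries it. -/
def freeVars : Formula L → Finset ℕ
  | equal t u => t.varFinset ∪ u.varFinset
  | rel _ ts => Finset.univ.biUnion fun i => (ts i).varFinset
  | neg φ => φ.freeVars
  | conn _ φ ψ => φ.freeVars ∪ ψ.freeVars
  | quant _ v V φ => (φ.freeVars \ {v}) ∪ V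

/-- The formula contains no quantifier. -/
def QuantifierFree : Formula L → Prop
  | equal _ _ => True
  | rel _ _ => True
  | neg φ => φ.QuantifierFree
  | conn _ φ ψ => φ.QuantifierFree ∧ ψ.QuantifierFree
  | quant _ _ _ _ => False

end Formula

/-! ### Team semantics -/

/-- Assignments of values in `A` to variables, as partial functions: `s x = none` means that `x`
is not in the domain of `s`. A team is a set of assignments with a common finite domain; all
teams that arise below from the team `{∅}` are of this kind. -/
abbrev Assignment (A : Type) : Type := ℕ → Option A

section TeamSemantics

variable {A : Type}

/-- `s(a/v)` -/
def Assignment.set (s : Assignment A) (v : ℕ) (a : A) : Assignment A :=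
  Function.update s v (some a)

/-- The duplicated team `X[A/v]`. -/
def duplicate (X : Set (Assignment A)) (v : ℕ) : Set (Assignment A) :=
  {r | ∃ s ∈ X, ∃ a : A, r = s.set v a}

/-- The supplement team `X[F/v]`. -/
def supplement (X : Set (Assignment A)) (F : Assignment A → A) (v : ℕ) : Set (Assignment A) :=
  {r | ∃ s ∈ X, r = s.set v (F s)}

/-- `s ∼_V s'`: the assignments agree on the variables of the domain that are not in `V`. -/
def EquivOutside (V : Finset ℕ) (s s' : Assignment A) : Prop :=
  ∀ x, s x ≠ none → x ∉ V → s x = s' x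

/-- The function `F` is `V`-uniform on the team `X`. -/
def Uniform (X : Set (Assignment A)) (V : Finset ℕ) (F : Assignment A → A) : Prop :=
  ∀ s ∈ X, ∀ s' ∈ X, EquivOutside V s s' → F s = F s'

variable {L : FirstOrder.Language.{0, 0}} [Nonempty A] [L.Structure A]

/-- The value of a term under an assignment whose domain contains the variables of the term
(outside the domain of the assignment an arbitrary value is used). -/
noncomputable def termValue (s : Assignment A) (t : L.Term ℕ) : A :=
  t.realize fun x => (s x).getD (Classical.arbitrary A)

/-- `Sat φ true X` is satisfaction `A, X ⊨ φ` and `Sat φ false X` is negative satisfaction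
`A, X ⊨⁻ φ` of an IF formula by a team. -/
def Sat : Formula L → Bool → Set (Assignment A) → Prop
  | .equal t u, true, X => ∀ s ∈ X, termValue s t = termValue s u
  | .equal t u, false, X => ∀ s ∈ X, ¬ termValue s t = termValue s u
  | .rel R ts, true, X => ∀ s ∈ X, FirstOrder.Language.Structure.RelMap R
      fun i => termValue s (ts i)
  | .rel R ts, false, X => ∀ s ∈ X, ¬ FirstOrder.Language.Structure.RelMap R
      fun i => termValue s (ts i)
  | .neg φ, b, X => Sat φ (!b) X
  | .conn .and φ ψ, true, X => Sat φ true X ∧ Sat ψ true X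
  | .conn .and φ ψ, false, X => ∃ Y Z, Y ∪ Z = X ∧ Sat φ false Y ∧ Sat ψ false Z
  | .conn .or φ ψ, true, X => ∃ Y Z, Y ∪ Z = X ∧ Sat φ true Y ∧ Sat ψ true Z
  | .conn .or φ ψ, false, X => Sat φ false X ∧ Sat ψ false X
  | .quant .all v _ φ, true, X => Sat φ true (duplicate X v)
  | .quant .all v V φ, false, X => ∃ F, Uniform X V F ∧ Sat φ false (supplement X F v)
  | .quant .ex v V φ, true, X => ∃ F, Uniform X V F ∧ Sat φ true (supplement X F v)
  | .quant .ex v _ φ, false, X => Sat φ false (duplicate X v)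

/-- Truth of a sentence in the structure `A`: satisfaction by the team whose only member is the
empty assignment. -/
def IsTrueIn (A : Type) [Nonempty A] [L.Structure A] (φ : Formula L) : Prop :=
  Sat φ true ({fun _ => none} : Set (Assignment A))

end TeamSemantics

/-! ### Positive initial trees -/

/-- Positive initial trees, that is, finite syntactical trees built from connectives and slashed
quantifiers only. The tree `T` is given together with its gaps, i.e. as the completed tree
`T̂`; `gap` is the empty tree. -/
inductive PosTree : Type
  | gap : PosTree
  | conn (c : Connective) (l r : PosTree) : PosTree
  | quant (q : Quantifier) (v : ℕ) (V : Finset ℕ) (t : PosTree) : PosTree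

namespace PosTree

/-- The nodes of a tree (gaps are not nodes). -/
inductive Node : PosTree → Type
  | connRoot {c : Connective} {l r : PosTree} : Node (conn c l r)
  | left {c : Connective} {l r : PosTree} (n : Node l) : Node (conn c l r)
  | right {c : Connective} {l r : PosTree} (n : Node r) : Node (conn c l r)
  | quantRoot {q : Quantifier} {v : ℕ} {V : Finset ℕ} {t : PosTree} : Node (quant q v V t)
  | under {q : Quantifier} {v : ℕ} {V : Finset ℕ} {t : PosTree} (n : Node t) :
      Node (quant q v V t)

/-- The logical operator of which a node is an occurrence. -/
inductive Label : Type
  | conn (c : Connective) : Label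
  | quant (q : Quantifier) (v : ℕ) (V : Finset ℕ) : Label

/-- The operator at a node. -/
def Node.label : {T : PosTree} → Node T → Label
  | PosTree.conn c _ _, .connRoot => .conn c
  | _, .left n => n.label
  | _, .right n => n.label
  | PosTree.quant q v V _, .quantRoot => .quant q v V
  | _, .under n => n.label

/-- `Prec m n` (in symbols `m ≺ n`): the node `m` is strictly superordinated to the node `n`. -/
inductive Prec : {T : PosTree} → Node T → Node T → Prop
  | root_left {c : Connective} {l r : PosTree} (n : Node l) :
      Prec (Node.connRoot (c := c) (l := l) (r := r)) (Node.left n)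
  | root_right {c : Connective} {l r : PosTree} (n : Node r) :
      Prec (Node.connRoot (c := c) (l := l) (r := r)) (Node.right n)
  | root_under {q : Quantifier} {v : ℕ} {V : Finset ℕ} {t : PosTree} (n : Node t) :
      Prec (Node.quantRoot (q := q) (v := v) (V := V)) (Node.under n)
  | left {c : Connective} {l r : PosTree} {m n : Node l} (h : Prec m n) :
      Prec (Node.left (c := c) (r := r) m) (Node.left n)
  | right {c : Connective} {l r : PosTree} {m n : Node r} (h : Prec m n) :
      Prec (Node.right (c := c) (l := l) m) (Node.right n)
  | under {q : Quantifier} {v : ℕ} {V : Finset ℕ} {t : PosTree} {m n : Node t} (h : Prec m n) :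
      Prec (Node.under (q := q) (v := v) (V := V) m) (Node.under n)

/-- The nodes `m` and `n` lie in two different branches below the node `c`: both are
subordinated to `c`, and no node strictly below `c` is superordinated or equal to both. -/
def InDifferentBranches {T : PosTree} (c m n : Node T) : Prop :=
  Prec c m ∧ Prec c n ∧
    ¬ ∃ d, Prec c d ∧ (d = m ∨ Prec d m) ∧ (d = n ∨ Prec d n)

/-- The quantifier at the node `n` depends on the quantifier at the node `m`: it is subordinated
to it and does not have its variable in the slash set. -/
def DependsOn {T : PosTree} (n m : Node T) : Prop :=
  ∃ q v V q' w W, m.label = .quant q v V ∧ n.label = .quant q' w W ∧ Prec m n ∧ v ∉ W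

/-- The tree `U` extends the tree `T`. -/
def Extends (U T : PosTree) : Prop :=
  ∃ μ : Node T → Node U, Function.Injective μ ∧
    (∀ n q v V, n.label = .quant q v V → ∃ V', (μ n).label = .quant q v V') ∧
    (∀ n c, n.label = .conn c → (μ n).label = .conn c) ∧
    (∀ m n, Prec m n → Prec (μ m) (μ n)) ∧
    (∀ c m n, InDifferentBranches c m n → InDifferentBranches (μ c) (μ m) (μ n)) ∧
    (∀ m n, DependsOn n m ↔ DependsOn (μ n) (μ m))

/-- The free variables of a tree. -/
def freeVars : PosTree → Finset ℕ
  | gap => ∅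
  | conn _ l r => l.freeVars ∪ r.freeVars
  | quant _ v V t => (t.freeVars \ {v}) ∪ V

/-- The bound (i.e. quantified) variables of a tree. -/
def boundVars : PosTree → Finset ℕ
  | gap => ∅
  | conn _ l r => l.boundVars ∪ r.boundVars
  | quant _ v _ t => insert v t.boundVars

/-- A tree is regular if no variable occurs in it both free and bound, and no quantifier is
subordinated to a quantifier of the same variable. -/
def Regular (T : PosTree) : Prop :=
  Disjoint T.freeVars T.boundVars ∧
    ∀ m n : Node T, Prec m n → ∀ q v V q' w W,
      m.label = .quant q v V → n.label = .quant q' w W → v ≠ w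

/-- The paths of a tree `T`: the maximal linear suborders of `T̂`, each of them given by the gap
at its end. -/
inductive Path : PosTree → Type
  | gap : Path gap
  | left {c : Connective} {l r : PosTree} (p : Path l) : Path (conn c l r)
  | right {c : Connective} {l r : PosTree} (p : Path r) : Path (conn c l r)
  | under {q : Quantifier} {v : ℕ} {V : Finset ℕ} {t : PosTree} (p : Path t) :
      Path (quant q v V t)

/-- The variables that are quantified along a path. -/
def Path.boundVars : {T : PosTree} → Path T → Finset ℕ
  | _, .gap => ∅
  | _, .left p => p.boundVars
  | _, .right p => p.boundVars
  | PosTree.quant _ v _ _, .under p => insert v p.boundVars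

/-- The formula `ê(T)` that results from attaching the formula `e p` at the end of every path
`p` of `T`. -/
def complete {L : FirstOrder.Language.{0, 0}} :
    (T : PosTree) → (Path T → Formula L) → Formula L
  | gap, e => e .gap
  | conn c l r, e =>
      .conn c (l.complete fun p => e (.left p)) (r.complete fun p => e (.right p))
  | quant q v V t, e => .quant q v V (t.complete fun p => e (.under p))

/-- The completing function is weak: its values are quantifier-free. -/
def Weak {L : FirstOrder.Language.{0, 0}} {T : PosTree} (e : Path T → Formula L) : Prop :=
  ∀ p, (e p).QuantifierFree

/-- The completing function is sentential: the formula at the end of a path only has free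
variables that are quantified along the path. -/
def Sentential {L : FirstOrder.Language.{0, 0}} {T : PosTree} (e : Path T → Formula L) : Prop :=
  ∀ p, (e p).freeVars ⊆ p.boundVars

end PosTree

/-! ### Turing machines with a read-only input tape -/

/-- What a machine reads on its input tape: an end marker or a bit of the input. -/
inductive InputSymbol : Type
  | leftEnd
  | bit (b : Bool)
  | rightEnd

/-- The content of position `i` of the input tape; the input occupies the positions
`1, …, |w|`, between two end markers. -/
def readInput (w : List Bool) : ℕ → InputSymbol
  | 0 => .leftEnd
  | i + 1 => match w[i]? with
    | some b => .bit b
    | none => .rightEnd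

/-- Head movements. -/
inductive Move : Type
  | left
  | stay
  | right

/-- The effect of a movement on a head position; a tape has a leftmost cell, number `0`. -/
def Move.apply : Move → ℕ → ℕ
  | left, i => i - 1
  | stay, i => i
  | right, i => i + 1

/-- What a machine with state set `Q`, work alphabet `Γ` and `k` work tapes does in one step: the
new state, the movement of the input head, the symbols written and the movements on the work
tapes, and possibly a bit that is appended to the write-only output tape. -/
structure Action (Q Γ : Type) (k : ℕ) : Type where
  state : Q
  inputMove : Move
  write : Fin k → Γ
  workMove : Fin k → Move
  output : Option Bool

/-- Nondeterministic multitape Turing machines with a read-only two-way input tape over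
`{0, 1}`, `k` read-write work tapes and a write-only output tape. The transition relation gives
the possible actions in terms of the state and the symbols under the heads. -/
structure Machine : Type 1 where
  Q : Type
  finite_Q : Finite Q
  Γ : Type
  finite_Γ : Finite Γ
  blank : Γ
  k : ℕ
  start : Q
  accept : Set Q
  δ : Q → InputSymbol → (Fin k → Γ) → Set (Action Q Γ k)

namespace Machine

/-- Configurations of a machine (for a fixed input). -/
structure Config (M : Machine) : Type where
  state : M.Q
  inputPos : ℕ
  work : Fin M.k → ℕ → M.Γ
  workPos : Fin M.k → ℕ
  output : List Bool

/-- The initial configuration. -/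
def initial (M : Machine) : M.Config where
  state := M.start
  inputPos := 0
  work := fun _ _ => M.blank
  workPos := fun _ => 0
  output := []

/-- The actions that are possible in a configuration on input `w`. -/
def enabled (M : Machine) (w : List Bool) (c : M.Config) : Set (Action M.Q M.Γ M.k) :=
  M.δ c.state (readInput w c.inputPos) fun i => c.work i (c.workPos i)

/-- The configuration after an action; the input head does not leave the end markers. -/
def perform (M : Machine) (w : List Bool) (c : M.Config) (a : Action M.Q M.Γ M.k) :
    M.Config where
  state := a.state
  inputPos := min (a.inputMove.apply c.inputPos) (w.length + 1)
  work := fun i => Function.update (c.work i) (c.workPos i) (a.write i)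
  workPos := fun i => (a.workMove i).apply (c.workPos i)
  output := c.output ++ a.output.toList

/-- `M.Reaches w m c`: on input `w` the machine has a computation of `m` steps that leads from the
initial configuration to `c`. -/
inductive Reaches (M : Machine) (w : List Bool) : ℕ → M.Config → Prop
  | zero : Reaches M w 0 M.initial
  | step {m : ℕ} {c : M.Config} {a : Action M.Q M.Γ M.k} (h : Reaches M w m c)
      (ha : a ∈ M.enabled w c) : Reaches M w (m + 1) (M.perform w c a)

/-- No action is possible. -/
def Halted (M : Machine) (w : List Bool) (c : M.Config) : Prop :=
  M.enabled w c = ∅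

/-- At most one action is possible at any time. -/
def Deterministic (M : Machine) : Prop :=
  ∀ q x g, (M.δ q x g).Subsingleton

/-- Some computation on input `w` halts in an accepting state. -/
def Accepts (M : Machine) (w : List Bool) : Prop :=
  ∃ m c, M.Reaches w m c ∧ M.Halted w c ∧ c.state ∈ M.accept

/-- Every computation on an input of length `n` has at most `p(n)` steps, for some polynomial
`p`. -/
def PolyTime (M : Machine) : Prop :=
  ∃ p : Polynomial ℕ, ∀ w m c, M.Reaches w m c → m ≤ p.eval w.length

/-- Every computation on an input of length `n` uses `O(log n)` cells of the work tapes. -/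
def LogSpace (M : Machine) : Prop :=
  ∃ C : ℕ, ∀ w m c, M.Reaches w m c → ∀ i, c.workPos i ≤ C * (Nat.log 2 w.length + 1)

/-- The (deterministic) machine halts on every input, with output `f w` on input `w`. -/
def Computes (M : Machine) (f : List Bool → List Bool) : Prop :=
  M.Deterministic ∧ ∀ w, ∃ m c, M.Reaches w m c ∧ M.Halted w c ∧ c.output = f w

end Machine

/-! ### Complexity classes, reductions and hardness -/

/-- The class NL. -/
def NL : Set (Set (List Bool)) :=
  {B | ∃ M : Machine, M.LogSpace ∧ ∀ w, w ∈ B ↔ M.Accepts w}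

/-- The class P. -/
def P : Set (Set (List Bool)) :=
  {B | ∃ M : Machine, M.Deterministic ∧ M.PolyTime ∧ ∀ w, w ∈ B ↔ M.Accepts w}

/-- The class NP. -/
def NP : Set (Set (List Bool)) :=
  {B | ∃ M : Machine, M.PolyTime ∧ ∀ w, w ∈ B ↔ M.Accepts w}

/-- Logarithmic space many-one reducibility. -/
def LogSpaceReducible (B A : Set (List Bool)) : Prop :=
  ∃ f, (∃ M : Machine, M.LogSpace ∧ M.Computes f) ∧ ∀ w, w ∈ B ↔ f w ∈ A

/-- Polynomial time many-one reducibility. -/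
def PolyTimeReducible (B A : Set (List Bool)) : Prop :=
  ∃ f, (∃ M : Machine, M.PolyTime ∧ M.Computes f) ∧ ∀ w, w ∈ B ↔ f w ∈ A

/-- NL-hard problems (under logarithmic space reductions). -/
def NLHard : Set (Set (List Bool)) := {A | ∀ B ∈ NL, LogSpaceReducible B A}

/-- P-hard problems (under logarithmic space reductions). -/
def PHard : Set (Set (List Bool)) := {A | ∀ B ∈ P, LogSpaceReducible B A}

/-- NP-hard problems (under polynomial time reductions). -/
def NPHard : Set (Set (List Bool)) := {A | ∀ B ∈ NP, PolyTimeReducible B A}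

/-! ### The model-checking problem -/

/-- The unary code `1ⁿ0` of a number. -/
def unary (n : ℕ) : List Bool := List.replicate n true ++ [false]

/-- The list of all `k`-tuples of elements of `Fin n`, in a lexicographic order. -/
def tuples (n k : ℕ) : List (Fin k → Fin n) :=
  List.ofFn fun i : Fin (n ^ k) => finFunctionFinEquiv.symm i

open Classical in
/-- The binary string that represents a structure with domain `{0, …, n}`: the code of the size
`n + 1` of the domain, followed by the value tables of the function symbols and by the
truth tables of the relation symbols. -/
noncomputable def encode (τ : Vocabulary) (n : ℕ) [τ.lang.Structure (Fin (n + 1))] : List Bool :=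
  unary (n + 1) ++
  ((List.finRange τ.funArity.length).flatMap fun i =>
    (tuples (n + 1) (τ.funArity.get i)).flatMap fun x =>
      unary (FirstOrder.Language.Structure.funMap (L := τ.lang) ⟨i, rfl⟩ x : Fin (n + 1)).val) ++
  ((List.finRange τ.relArity.length).flatMap fun i =>
    (tuples (n + 1) (τ.relArity.get i)).map fun x =>
      decide (FirstOrder.Language.Structure.RelMap (L := τ.lang) ⟨i, rfl⟩ x))

/-- The model-checking problem for `φ`, as a set of strings: the representations of the finite
structures (with nonempty domain) in which `φ` is true. -/
def modelChecking (τ : Vocabulary) (φ : Formula τ.lang) : Set (List Bool) :=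
  {w | ∃ (n : ℕ) (_ : τ.lang.Structure (Fin (n + 1))),
    w = encode τ n ∧ IsTrueIn (Fin (n + 1)) φ}

/-- The tree `T` encodes a problem of the class `H` of hard problems: for some weak, sentential
completing function `e`, over some finite vocabulary, the model-checking problem for `ê(T)` is
in `H`. -/
def PosTree.EncodesHard (T : PosTree) (H : Set (Set (List Bool))) : Prop :=
  ∃ (τ : Vocabulary) (e : PosTree.Path T → Formula τ.lang),
    PosTree.Weak e ∧ PosTree.Sentential e ∧ modelChecking τ (T.complete e) ∈ H

end IFLogic

namespace IFLogic

/-! ### Doubling the first zero of the output -/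

/-! A completing function `e` of T is turned into one of U, over the vocabulary with one new
constant c, such that both completed trees are true in the same structures. The operators of U
outside the image of the embedding must be made harmless. A superfluous connective loses one branch:
all gaps of that branch get a valid formula under ∧ and an unsatisfiable one under ∨. A superfluous
universal variable is never mentioned. A superfluous existential variable z is more dangerous, since
later quantifiers may see z and it could signal hidden values to them; so z = c is added at the
relevant gaps below it. Quantifiers in the image see the same relevant variables as in T, because
dependence is preserved in both directions, and they gain nothing from seeing dummies: fixing every
dummy at c turns choice functions for U into choice functions for T.

`Embeds` is the inductive form of the extension relation (`IsExtensionMap.embeds`), and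
`Embeds.exists_isTranslation` builds the new completing function along it. The closure properties of
`Translates` carry the semantic argument.

The new constant changes the strings that represent structures. It is listed first, so the code of
its value directly follows the code of the domain size; the value 0 is coded by a single zero, and
adding it amounts to doubling the first zero of the string
(`mem_modelChecking_iff_doubleFirstFalse`). A reduction can do this while it writes its output, with
a finite control and one extra step, so no composition theorem for logarithmic space is needed. -/

/-- The string that results from doubling the first zero. -/
def doubleFirstFalse : List Bool → List Bool
  | [] => []
  | true :: l => true :: doubleFirstFalse l
  | false :: l => false :: false :: l

theorem doubleFirstFalse_append_of_notMem {l : List Bool} (h : false ∉ l) (l' : List Bool) :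
    doubleFirstFalse (l ++ l') = l ++ doubleFirstFalse l' := by
  induction l with
  | nil => rfl
  | cons b l ih => cases b <;> simp_all [doubleFirstFalse]

theorem doubleFirstFalse_append_of_mem {l : List Bool} (h : false ∈ l) (l' : List Bool) :
    doubleFirstFalse (l ++ l') = doubleFirstFalse l ++ l' := by
  induction l with
  | nil => simp at h
  | cons b l ih => cases b <;> simp_all [doubleFirstFalse]

theorem doubleFirstFalse_of_notMem {l : List Bool} (h : false ∉ l) : doubleFirstFalse l = l := by
  simpa [doubleFirstFalse] using doubleFirstFalse_append_of_notMem h []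

/-! ### A transducer for doubling the first zero, and its resource bounds -/

namespace Machine

/-- The state of a transducer that doubles the first zero of a string. -/
inductive Phase : Type
  | searching
  | pending
  | done

instance : Finite Phase :=
  Finite.of_injective
    (fun p : Phase => match p with
      | .searching => (0 : Fin 3)
      | .pending => 1
      | .done => 2)
    (by rintro ⟨⟩ ⟨⟩ h <;> simp_all)

variable (M : Machine)

/-- An action of `M`, together with a new phase. -/
def withPhase {Q Γ : Type} {k : ℕ} (p : Option Bool → Phase) (a : Action Q Γ k) :
    Action (Q × Phase) Γ k where
  state := (a.state, p a.output)
  inputMove := a.inputMove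
  write := a.write
  workMove := a.workMove
  output := a.output

/-- The phase after an output symbol when no zero has been written before. -/
def searchStep : Option Bool → Phase
  | some false => .pending
  | _ => .searching

/-- The machine that works like `M` but doubles the first zero of the output. -/
def doubling : Machine where
  Q := M.Q × Phase
  finite_Q := have := M.finite_Q; inferInstance
  Γ := M.Γ
  finite_Γ := M.finite_Γ
  blank := M.blank
  k := M.k
  start := (M.start, .searching)
  accept := ∅
  δ := fun q x g => match q with
    | (q, .searching) => withPhase searchStep '' M.δ q x g
    | (q, .pending) => {⟨(q, .done), .stay, g, fun _ => .stay, some false⟩}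
    | (q, .done) => withPhase (fun _ => .done) '' M.δ q x g

variable {M}

/-- The configuration of `M.doubling` that belongs to a configuration of `M`. -/
def Config.lift (c : M.Config) (p : Phase) (o : List Bool) : M.doubling.Config where
  state := (c.state, p)
  inputPos := c.inputPos
  work := c.work
  workPos := c.workPos
  output := o

theorem Deterministic.doubling (h : M.Deterministic) : M.doubling.Deterministic := by
  rintro ⟨q, ⟨⟩⟩ x g
  · exact (h q x g).image _
  · exact Set.subsingleton_singleton
  · exact (h q x g).image _

variable {w : List Bool}

/-- Every step clamps the input head. The bound is needed because the extra step of `doubling`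
clamps too and must leave the head in place. -/
theorem Reaches.inputPos_le {m : ℕ} {c : M.Config} (h : M.Reaches w m c) :
    c.inputPos ≤ w.length + 1 := by
  cases h with
  | zero => exact Nat.zero_le _
  | step => exact min_le_right _ _

theorem enabled_lift_searching (c : M.Config) (o : List Bool) :
    M.doubling.enabled w (c.lift .searching o) = withPhase searchStep '' M.enabled w c := rfl

theorem enabled_lift_done (c : M.Config) (o : List Bool) :
    M.doubling.enabled w (c.lift .done o) = withPhase (fun _ => .done) '' M.enabled w c := rfl

theorem perform_lift_pending {c : M.Config} (hc : c.inputPos ≤ w.length + 1) (o : List Bool)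
    {a : Action (M.Q × Phase) M.Γ M.k}
    (ha : a ∈ M.doubling.enabled w (c.lift .pending o)) :
    M.doubling.perform w (c.lift .pending o) a = c.lift .done (o ++ [false]) := by
  obtain rfl : a = ⟨(c.state, .done), .stay, fun i => c.work i (c.workPos i), fun _ => .stay,
    some false⟩ := ha
  have h : min c.inputPos (w.length + 1) = c.inputPos := min_eq_left hc
  simp only [perform, Config.lift, Move.apply, Option.toList, h]
  congr 1
  funext i
  exact Function.update_eq_self _ _

/-- `c'` is a configuration of `M.doubling` after `m'` steps that corresponds to the configuration
`c` of `M` after `m` steps. -/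
def Simulates (m' : ℕ) (c' : M.doubling.Config) (m : ℕ) (c : M.Config) : Prop :=
  (false ∉ c.output ∧ c' = c.lift .searching c.output ∧ m' = m) ∨
  (doubleFirstFalse c.output = c.output ++ [false] ∧ false ∈ c.output ∧
    c' = c.lift .pending c.output ∧ m' = m) ∨
  (false ∈ c.output ∧ c' = c.lift .done (doubleFirstFalse c.output) ∧ m' = m + 1)

theorem simulates_step_searching {c : M.Config} (hc : false ∉ c.output) (m : ℕ)
    (a : Action M.Q M.Γ M.k) :
    Simulates (m + 1) ((M.perform w c a).lift (searchStep a.output)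
      (c.output ++ a.output.toList)) (m + 1) (M.perform w c a) := by
  have ho : (M.perform w c a).output = c.output ++ a.output.toList := rfl
  rcases h : a.output with _ | _ | _
  · left; rw [h] at ho; simp [ho, hc, searchStep]
  · right; left
    rw [h] at ho
    -- The zero just written is the first and the last symbol, so doubling it means appending one
    -- more zero.
    simp [ho, doubleFirstFalse_append_of_notMem hc, doubleFirstFalse, searchStep]
  · left; rw [h] at ho; simp [ho, hc, searchStep]

theorem simulates_step_done {c : M.Config} (hc : false ∈ c.output) (m : ℕ)
    (a : Action M.Q M.Γ M.k) :
    Simulates (m + 1 + 1) ((M.perform w c a).lift .done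
      (doubleFirstFalse c.output ++ a.output.toList)) (m + 1) (M.perform w c a) := by
  have ho : (M.perform w c a).output = c.output ++ a.output.toList := rfl
  right; right
  simp [ho, hc, doubleFirstFalse_append_of_mem hc]

/-- Every computation of `doubling` shadows one of `M` with the same work heads and at most one step
less; hence the space and time bounds carry over. -/
theorem Reaches.of_doubling {m' : ℕ} {c' : M.doubling.Config}
    (h : M.doubling.Reaches w m' c') : ∃ m c, M.Reaches w m c ∧ Simulates m' c' m c := by
  induction h with
  | zero => exact ⟨0, _, .zero, .inl ⟨List.not_mem_nil, rfl, rfl⟩⟩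
  | step h ha ih =>
    obtain ⟨m, c, hc, ⟨ho, rfl, rfl⟩ | ⟨hd, ho, rfl, rfl⟩ | ⟨ho, rfl, rfl⟩⟩ := ih
    · obtain ⟨a, ha, rfl⟩ := ha
      exact ⟨_, _, hc.step ha, simulates_step_searching ho _ a⟩
    · rw [perform_lift_pending hc.inputPos_le _ ha]
      exact ⟨_, _, hc, .inr (.inr ⟨ho, by rw [hd], rfl⟩)⟩
    · obtain ⟨a, ha, rfl⟩ := ha
      exact ⟨_, _, hc.step ha, simulates_step_done ho _ a⟩

/-- A pending configuration can always emit its second zero while `M` stands still. Afterwards the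
output is up to date and the enabled actions are those of `M`, which is what halting requires. -/
theorem Simulates.not_pending {m m' : ℕ} {c : M.Config} {c' : M.doubling.Config}
    (hc : M.Reaches w m c) (h' : M.doubling.Reaches w m' c') (h : Simulates m' c' m c) :
    ∃ m' c', M.doubling.Reaches w m' c' ∧ Simulates m' c' m c ∧
      ∃ p, p ≠ .pending ∧ c' = c.lift p (doubleFirstFalse c.output) := by
  obtain ⟨ho, rfl, rfl⟩ | ⟨hd, ho, rfl, rfl⟩ | ⟨ho, rfl, rfl⟩ := h
  · exact ⟨_, _, h', .inl ⟨ho, rfl, rfl⟩, .searching, by simp, by rw [doubleFirstFalse_of_notMem ho]⟩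
  · have h2 := h'.step (Set.mem_singleton _)
    rw [perform_lift_pending hc.inputPos_le _ (Set.mem_singleton _), ← hd] at h2
    exact ⟨_, _, h2, .inr (.inr ⟨ho, rfl, rfl⟩), .done, by simp, rfl⟩
  · exact ⟨_, _, h', .inr (.inr ⟨ho, rfl, rfl⟩), .done, by simp, rfl⟩

theorem Reaches.doubling {m : ℕ} {c : M.Config} (h : M.Reaches w m c) :
    ∃ m' p, p ≠ Phase.pending ∧
      M.doubling.Reaches w m' (c.lift p (doubleFirstFalse c.output)) := by
  suffices ∃ m' c', M.doubling.Reaches w m' c' ∧ Simulates m' c' m c by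
    obtain ⟨m', c', h', hs⟩ := this
    obtain ⟨m', c', h', -, p, hp, rfl⟩ := hs.not_pending h h'
    exact ⟨m', p, hp, h'⟩
  induction h with
  | zero => exact ⟨0, _, .zero, .inl ⟨List.not_mem_nil, rfl, rfl⟩⟩
  | step h ha ih =>
    obtain ⟨m', c', h', hs⟩ := ih
    obtain ⟨m', c', h', hs, p, hp, rfl⟩ := hs.not_pending h h'
    obtain ⟨ho, hc, rfl⟩ | ⟨hd, ho, hc, rfl⟩ | ⟨ho, hc, rfl⟩ := hs
    · rw [hc] at h'
      exact ⟨_, _, h'.step ⟨_, ha, rfl⟩, simulates_step_searching ho _ _⟩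
    · exact absurd (congrArg (fun c => c.state.2) hc) hp
    · rw [hc] at h'
      exact ⟨_, _, h'.step ⟨_, ha, rfl⟩, simulates_step_done ho _ _⟩

theorem Computes.doubling {f : List Bool → List Bool} (h : M.Computes f) :
    M.doubling.Computes (doubleFirstFalse ∘ f) := by
  refine ⟨h.1.doubling, fun w => ?_⟩
  obtain ⟨m, c, hc, hh, ho⟩ := h.2 w
  obtain ⟨m', p, hp, h'⟩ := hc.doubling
  refine ⟨m', _, h', ?_, congrArg _ ho⟩
  have hh : M.enabled w c = ∅ := hh
  cases p with
  | searching => exact (enabled_lift_searching _ _).trans (by rw [hh]; exact Set.image_empty _)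
  | pending => exact absurd rfl hp
  | done => exact (enabled_lift_done _ _).trans (by rw [hh]; exact Set.image_empty _)

theorem LogSpace.doubling (h : M.LogSpace) : M.doubling.LogSpace := by
  obtain ⟨C, hC⟩ := h
  refine ⟨C, fun w m' c' h' i => ?_⟩
  obtain ⟨m, c, hc, ⟨-, rfl, -⟩ | ⟨-, -, rfl, -⟩ | ⟨-, rfl, -⟩⟩ := h'.of_doubling
  all_goals exact hC w m c hc i

theorem PolyTime.doubling (h : M.PolyTime) : M.doubling.PolyTime := by
  obtain ⟨p, hp⟩ := h
  refine ⟨p + 1, fun w m' c' h' => ?_⟩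
  obtain ⟨m, c, hc, hs⟩ := h'.of_doubling
  have := hp w m c hc
  rw [Polynomial.eval_add, Polynomial.eval_one]
  obtain ⟨-, -, rfl⟩ | ⟨-, -, -, rfl⟩ | ⟨-, -, rfl⟩ := hs <;> omega

end Machine

/-! ### Transfer to reductions -/

theorem LogSpaceReducible.doubleFirstFalse {A A' B : Set (List Bool)}
    (hA : ∀ w, w ∈ A ↔ doubleFirstFalse w ∈ A') (h : LogSpaceReducible B A) :
    LogSpaceReducible B A' := by
  obtain ⟨f, ⟨M, hM, hf⟩, h⟩ := h
  exact ⟨_, ⟨_, hM.doubling, hf.doubling⟩, fun w => (h w).trans (hA _)⟩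

theorem PolyTimeReducible.doubleFirstFalse {A A' B : Set (List Bool)}
    (hA : ∀ w, w ∈ A ↔ doubleFirstFalse w ∈ A') (h : PolyTimeReducible B A) :
    PolyTimeReducible B A' := by
  obtain ⟨f, ⟨M, hM, hf⟩, h⟩ := h
  exact ⟨_, ⟨_, hM.doubling, hf.doubling⟩, fun w => (h w).trans (hA _)⟩

/-! ### Adding a constant to a vocabulary -/

open FirstOrder FirstOrder.Language

namespace Vocabulary

variable (τ : Vocabulary)

/-- The vocabulary `τ` with a new constant, which precedes the other function symbols. -/
def addConstant : Vocabulary where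
  funArity := 0 :: τ.funArity
  relArity := τ.relArity

/-- The new constant. -/
def newConstant : τ.addConstant.lang.Constants :=
  ⟨(0 : Fin (τ.funArity.length + 1)), rfl⟩

/-- The inclusion of the old language. -/
def inclusion : τ.lang →ᴸ τ.addConstant.lang where
  onFunction := fun _ f => ⟨Fin.succ f.1, f.2⟩
  onRelation := fun _ R => R

variable {τ}

/-- The expansion of a structure that has the value `a` for the new constant. -/
@[reducible]
def expand {A : Type} (S : τ.lang.Structure A) (a : A) : τ.addConstant.lang.Structure A where
  funMap := fun {k} f x => match f with
    | ⟨⟨0, _⟩, _⟩ => a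
    | ⟨⟨i + 1, hi⟩, h⟩ => S.funMap (n := k) ⟨⟨i, Nat.lt_of_succ_lt_succ hi⟩, h⟩ x
  RelMap := fun {k} R x => S.RelMap (n := k) R x

/-- The new constant is the first function symbol and its table has one entry, so the two codes
differ by one block right after the domain size. -/
theorem encode_addConstant (n : ℕ) (S : τ.addConstant.lang.Structure (Fin (n + 1))) :
    ∃ l, encode τ.addConstant n =
        unary (n + 1) ++ (unary (S.funMap τ.newConstant default).val ++ l) ∧
      @encode τ n (τ.inclusion.reduct _) = unary (n + 1) ++ l := by
  refine ⟨_, ?_, List.append_assoc _ _ _⟩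
  simp only [encode, addConstant, List.length_cons, List.finRange_succ, List.flatMap_cons,
    List.flatMap_map, List.append_assoc]
  congr 1
  refine congrArg₂ _ ?_ rfl
  have ht : tuples (n + 1) 0 = [default] := by
    simp [tuples, List.ofFn_succ, eq_iff_true_of_subsingleton]
  change (tuples (n + 1) 0).flatMap _ = _
  rw [ht]
  exact List.append_nil _

end Vocabulary

theorem doubleFirstFalse_unary_append (n : ℕ) (l : List Bool) :
    doubleFirstFalse (unary n ++ l) = unary n ++ false :: l := by
  induction n with
  | zero => rfl
  | succ n ih => exact congrArg (true :: ·) ih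

theorem doubleFirstFalse_eq_unary_append {w : List Bool} {n : ℕ} {l : List Bool}
    (h : doubleFirstFalse w = unary n ++ l) : ∃ l', l = false :: l' ∧ w = unary n ++ l' := by
  induction n generalizing w with
  | zero =>
    match w, h with
    | false :: w, h =>
      obtain rfl : false :: w = l := (List.cons.inj h).2
      exact ⟨w, rfl, rfl⟩
  | succ n ih =>
    match w, h with
    | true :: w, h =>
      obtain ⟨l', rfl, rfl⟩ := ih (List.cons.inj h).2
      exact ⟨l', rfl, rfl⟩

theorem unary_append_eq_false_cons {n : ℕ} {l l' : List Bool} (h : unary n ++ l = false :: l') :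
    n = 0 ∧ l = l' := by
  cases n with
  | zero => exact ⟨rfl, (List.cons.inj h).2⟩
  | succ n => exact absurd (List.cons.inj h).1 (by simp)

/-- If `φ` and `ψ` have the same finite models up to the interpretation of the new constant, the
model-checking problem for `φ` is reducible to the one for `ψ` by doubling the first zero. -/
theorem mem_modelChecking_iff_doubleFirstFalse {τ : Vocabulary} {φ : Formula τ.lang}
    {ψ : Formula τ.addConstant.lang}
    (h : ∀ (n : ℕ) (_ : τ.addConstant.lang.Structure (Fin (n + 1))),
      @IsTrueIn _ (Fin (n + 1)) _ (τ.inclusion.reduct _) φ ↔ IsTrueIn (Fin (n + 1)) ψ)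
    (w : List Bool) :
    w ∈ modelChecking τ φ ↔ doubleFirstFalse w ∈ modelChecking τ.addConstant ψ := by
  constructor
  · rintro ⟨n, S, rfl, hφ⟩
    -- The value 0 is chosen because `unary 0` is a single zero.
    obtain ⟨l, hl, hl'⟩ := Vocabulary.encode_addConstant n (Vocabulary.expand S 0)
    refine ⟨n, Vocabulary.expand S 0, ?_, (h n _).1 hφ⟩
    rw [hl]
    refine (congrArg doubleFirstFalse hl').trans ?_
    exact doubleFirstFalse_unary_append _ _
  · rintro ⟨n, S, hw, hψ⟩
    obtain ⟨l, hl, hl'⟩ := Vocabulary.encode_addConstant n S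
    rw [hl] at hw
    obtain ⟨l', hl'', rfl⟩ := doubleFirstFalse_eq_unary_append hw
    -- The doubled zero forces the constant to have the value 0, so deleting it gives the code of
    -- the reduct.
    obtain ⟨-, rfl⟩ := unary_append_eq_false_cons hl''
    exact ⟨n, τ.inclusion.reduct _, hl'.symm, (h n _).2 hψ⟩

/-! ### Quantifier-free formulas -/

namespace Formula

variable {L L' : FirstOrder.Language.{0, 0}}

/-- Truth of a quantifier-free formula under a single assignment (quantified formulas get the
value `True`). -/
def Holds {A : Type} [Nonempty A] [L.Structure A] (s : Assignment A) : Formula L → Prop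
  | equal t u => termValue s t = termValue s u
  | rel R ts => Structure.RelMap R fun i => termValue s (ts i)
  | neg φ => ¬ φ.Holds s
  | conn .and φ ψ => φ.Holds s ∧ ψ.Holds s
  | conn .or φ ψ => φ.Holds s ∨ ψ.Holds s
  | quant _ _ _ _ => True

/-- The translation of a formula along a map of languages. -/
def onFormula (g : L →ᴸ L') : Formula L → Formula L'
  | equal t u => equal (g.onTerm t) (g.onTerm u)
  | rel R ts => rel (g.onRelation R) fun i => g.onTerm (ts i)
  | neg φ => neg (φ.onFormula g)
  | conn c φ ψ => conn c (φ.onFormula g) (ψ.onFormula g)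
  | quant q v V φ => quant q v V (φ.onFormula g)

theorem varFinset_onTerm (g : L →ᴸ L') (t : L.Term ℕ) : (g.onTerm t).varFinset = t.varFinset := by
  induction t with
  | var => rfl
  | func f ts ih => exact Finset.biUnion_congr rfl fun i _ => ih i

theorem freeVars_onFormula (g : L →ᴸ L') (φ : Formula L) :
    (φ.onFormula g).freeVars = φ.freeVars := by
  induction φ with
  | equal => simp [onFormula, freeVars, varFinset_onTerm]
  | rel => simp [onFormula, freeVars, varFinset_onTerm]
  | neg φ ih => exact ih
  | conn c φ ψ ih ih' => simp [onFormula, freeVars, ih, ih']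
  | quant q v V φ ih => simp [onFormula, freeVars, ih]

theorem QuantifierFree.onFormula (g : L →ᴸ L') {φ : Formula L} (h : φ.QuantifierFree) :
    (φ.onFormula g).QuantifierFree := by
  induction φ with
  | equal => trivial
  | rel => trivial
  | neg φ ih => exact ih h
  | conn c φ ψ ih ih' => exact ⟨ih h.1, ih' h.2⟩
  | quant => exact h

section Semantics

variable {A : Type} [Nonempty A] [L.Structure A]

theorem termValue_congr {s s' : Assignment A} {t : L.Term ℕ}
    (h : ∀ x ∈ t.varFinset, s x = s' x) : termValue s t = termValue s' t := by
  unfold termValue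
  induction t with
  | var x => simp [h x (Finset.mem_singleton_self x)]
  | func f ts ih =>
    simp only [Term.realize_func]
    congr 1
    funext i
    exact ih i fun x hx => h x (Finset.mem_biUnion.2 ⟨i, Finset.mem_univ i, hx⟩)

theorem holds_congr {s s' : Assignment A} {φ : Formula L} (h : ∀ x ∈ φ.freeVars, s x = s' x) :
    φ.Holds s ↔ φ.Holds s' := by
  induction φ with
  | equal t u =>
    simp only [freeVars, Finset.mem_union] at h
    simp only [Holds]
    rw [termValue_congr fun x hx => h x (.inl hx), termValue_congr fun x hx => h x (.inr hx)]
  | rel R ts =>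
    have : (fun i => termValue s (ts i)) = fun i => termValue s' (ts i) := by
      funext i
      exact termValue_congr fun x hx => h x (Finset.mem_biUnion.2 ⟨i, Finset.mem_univ i, hx⟩)
    simp only [Holds, this]
  | neg φ ih => exact not_congr (ih h)
  | conn c φ ψ ih ih' =>
    have h1 := ih fun x hx => h x (Finset.mem_union_left _ hx)
    have h2 := ih' fun x hx => h x (Finset.mem_union_right _ hx)
    cases c <;> simp only [Holds, h1, h2]
  | quant => exact Iff.rfl

theorem termValue_onTerm [L'.Structure A] (g : L →ᴸ L') [g.IsExpansionOn A]
    (s : Assignment A) (t : L.Term ℕ) :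
    termValue s (g.onTerm t) = termValue s t :=
  LHom.realize_onTerm _ _ _

theorem holds_onFormula [L'.Structure A] (g : L →ᴸ L') [g.IsExpansionOn A]
    (s : Assignment A) (φ : Formula L) :
    (φ.onFormula g).Holds s ↔ φ.Holds s := by
  induction φ with
  | equal => simp [onFormula, Holds, termValue_onTerm g]
  | rel => simp [onFormula, Holds, termValue_onTerm g]
  | neg φ ih => exact not_congr ih
  | conn c φ ψ ih ih' => cases c <;> simp only [onFormula, Holds, ih, ih']
  | quant => exact Iff.rfl

/-- The two parts of a split may overlap, so the maximal parts work. This is the flatness of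
disjunction. -/
theorem exists_union_eq_iff {α : Type} {X : Set α} {p q : α → Prop} :
    (∃ Y Z, Y ∪ Z = X ∧ (∀ s ∈ Y, p s) ∧ ∀ s ∈ Z, q s) ↔ ∀ s ∈ X, p s ∨ q s := by
  constructor
  · rintro ⟨Y, Z, rfl, hY, hZ⟩ s (h | h)
    exacts [.inl (hY s h), .inr (hZ s h)]
  · intro h
    refine ⟨{s ∈ X | p s}, {s ∈ X | q s}, ?_, fun s hs => hs.2, fun s hs => hs.2⟩
    ext s
    simpa [← and_or_left] using h s

/-- Quantifier-free formulas are flat. -/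
theorem QuantifierFree.sat_iff {φ : Formula L} (h : φ.QuantifierFree) (X : Set (Assignment A)) :
    (Sat φ true X ↔ ∀ s ∈ X, φ.Holds s) ∧ (Sat φ false X ↔ ∀ s ∈ X, ¬ φ.Holds s) := by
  -- Both polarities go through the induction together, since negation exchanges them.
  induction φ generalizing X with
  | equal => simp [Sat, Holds]
  | rel => simp [Sat, Holds]
  | neg φ ih => simpa [Sat, Holds] using (ih h X).symm
  | conn c φ ψ ih ih' =>
    cases c
    · simp only [Sat, Holds, (ih h.1 _).1, (ih' h.2 _).1, (ih h.1 _).2, (ih' h.2 _).2,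
        not_and_or]
      exact ⟨forall₂_and.symm, exists_union_eq_iff⟩
    · simp only [Sat, Holds, (ih h.1 _).1, (ih' h.2 _).1, (ih h.1 _).2, (ih' h.2 _).2,
        not_or]
      exact ⟨exists_union_eq_iff, forall₂_and.symm⟩
  | quant => exact h.elim

/-- The empty team property lets a discarded disjunct receive no assignments. -/
theorem sat_empty (φ : Formula L) (b : Bool) : Sat φ b (∅ : Set (Assignment A)) := by
  have hd (v : ℕ) : duplicate (∅ : Set (Assignment A)) v = ∅ := by
    simp [duplicate]
  have hs (F : Assignment A → A) (v : ℕ) : supplement ∅ F v = ∅ := by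
    simp [supplement]
  have hu (V : Finset ℕ) (F : Assignment A → A) : Uniform ∅ V F := by simp [Uniform]
  induction φ generalizing b with
  | equal => cases b <;> simp [Sat]
  | rel => cases b <;> simp [Sat]
  | neg φ ih => exact ih _
  | conn c φ ψ ih ih' =>
    cases c <;> cases b
    exacts [⟨∅, ∅, Set.union_self _, ih _, ih' _⟩, ⟨ih _, ih' _⟩, ⟨ih _, ih' _⟩,
      ⟨∅, ∅, Set.union_self _, ih _, ih' _⟩]
  | quant q v V φ ih =>
    cases q <;> cases b <;> simp only [Sat, hd, hs, ih]
    exacts [⟨fun _ => Classical.arbitrary A, hu _ _, trivial⟩,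
      ⟨fun _ => Classical.arbitrary A, hu _ _, trivial⟩]

end Semantics

end Formula

/-! ### Trees with constant completions -/

namespace PosTree

variable {L : FirstOrder.Language.{0, 0}} {A : Type} [Nonempty A] [L.Structure A]

theorem sat_complete_of_forall {φ : Formula L} (h : ∀ X : Set (Assignment A), Sat φ true X)
    (T : PosTree) (X : Set (Assignment A)) : Sat (T.complete fun _ => φ) true X := by
  induction T generalizing X with
  | gap => exact h X
  | conn c l r ihl ihr =>
    cases c
    exacts [⟨ihl X, ihr X⟩, ⟨X, X, Set.union_self X, ihl X, ihr X⟩]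
  | quant q v V t ih =>
    cases q
    exacts [ih _, ⟨fun _ => Classical.arbitrary A, fun _ _ _ _ _ => rfl, ih _⟩]

/-- Over a nonempty domain no quantifier can empty a nonempty team, and a split of a nonempty team
has a nonempty part. -/
theorem eq_empty_of_sat_complete {φ : Formula L}
    (h : ∀ X : Set (Assignment A), Sat φ true X → X = ∅)
    (T : PosTree) (X : Set (Assignment A)) (hX : Sat (T.complete fun _ => φ) true X) : X = ∅ := by
  induction T generalizing X with
  | gap => exact h X hX
  | conn c l r ihl ihr =>
    cases c
    · exact ihl X hX.1
    · obtain ⟨Y, Z, rfl, hY, hZ⟩ := hX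
      rw [ihl Y hY, ihr Z hZ, Set.union_self]
  | quant q v V t ih =>
    rw [Set.eq_empty_iff_forall_notMem]
    intro s hs
    cases q
    · exact Set.eq_empty_iff_forall_notMem.1 (ih _ hX) _ ⟨s, hs, Classical.arbitrary A, rfl⟩
    · obtain ⟨F, -, hX⟩ := hX
      exact Set.eq_empty_iff_forall_notMem.1 (ih _ hX) _ ⟨s, hs, rfl⟩

end PosTree

/-! ### Formulas with dummy variables -/

namespace Assignment

variable {A : Type}

/-- The restriction of an assignment to the variables in `D`. -/
def restrict (D : Finset ℕ) (s : Assignment A) : Assignment A :=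
  fun x => if x ∈ D then s x else none

/-- The assignment that has the value `a` on the variables in `Z` and agrees with `s` on the
others. -/
def extend (Z : Finset ℕ) (a : A) (s : Assignment A) : Assignment A :=
  fun x => if x ∈ Z then some a else s x

theorem restrict_empty (s : Assignment A) : s.restrict ∅ = fun _ => none := by
  funext x; simp [restrict]

theorem extend_empty (a : A) (s : Assignment A) : s.extend ∅ a = s := by
  funext x; simp [extend]

theorem set_self (s : Assignment A) (v : ℕ) (a : A) : s.set v a v = some a :=
  Function.update_self ..

theorem set_of_ne (s : Assignment A) {v x : ℕ} (h : x ≠ v) (a : A) : s.set v a x = s x :=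
  Function.update_of_ne h ..

theorem restrict_set_of_notMem {D : Finset ℕ} {z : ℕ} (h : z ∉ D) (s : Assignment A) (a : A) :
    (s.set z a).restrict D = s.restrict D := by
  funext x
  by_cases hx : x ∈ D
  · simp [restrict, hx, set_of_ne s (ne_of_mem_of_not_mem hx h)]
  · simp [restrict, hx]

theorem restrict_insert_set (D : Finset ℕ) (v : ℕ) (s : Assignment A) (a : A) :
    (s.set v a).restrict (insert v D) = (s.restrict D).set v a := by
  funext x
  by_cases hx : x = v
  · subst hx; simp [restrict, set_self]
  · simp [restrict, hx, set_of_ne]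

theorem extend_set_of_notMem {Z : Finset ℕ} {v : ℕ} (h : v ∉ Z) (s : Assignment A) (a b : A) :
    (s.set v b).extend Z a = (s.extend Z a).set v b := by
  funext x
  by_cases hx : x = v
  · subst hx; simp [extend, set_self, h]
  · simp [extend, hx, set_of_ne]

theorem extend_insert (Z : Finset ℕ) (z : ℕ) (s : Assignment A) (a : A) :
    s.extend (insert z Z) a = (s.extend Z a).set z a := by
  funext x
  by_cases hx : x = z
  · subst hx; simp [extend, set_self]
  · simp [extend, hx, set_of_ne]

theorem mem_of_set_ne_none {D : Finset ℕ} {v : ℕ} {s : Assignment A}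
    (h : ∀ x, s x ≠ none → x ∈ D) (b : A) (x : ℕ)
    (hx : s.set v b x ≠ none) : x ∈ insert v D := by
  rw [Finset.mem_insert, or_iff_not_imp_left]
  intro hxv
  rw [set_of_ne _ hxv] at hx
  exact h x hx

end Assignment

variable {L L' : FirstOrder.Language.{0, 0}}

/-- The formula `ψ` says the same as `φ` in the presence of dummy variables: `φ` is evaluated
on teams with domain `D`, and `ψ` on teams with domain `D ∪ Z`, where `E` lists dummy variables
that `ψ` forces to have the value `a`. -/
structure Translates {A : Type} [Nonempty A] [L.Structure A] [L'.Structure A] (a : A)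
    (D Z : Finset ℕ) (E : List ℕ) (φ : Formula L) (ψ : Formula L') : Prop where
  sat_right : ∀ X X' : Set (Assignment A), (∀ s ∈ X', s.restrict D ∈ X) →
    (∀ s ∈ X', ∀ z ∈ E, s z = some a) → Sat φ true X → Sat ψ true X'
  sat_left : ∀ X X' : Set (Assignment A), (∀ s ∈ X, ∀ x, s x ≠ none → x ∈ D) →
    (∀ s ∈ X, s.extend Z a ∈ X') → Sat ψ true X' → Sat φ true X
  pinned : ∀ X' : Set (Assignment A), Sat ψ true X' →
    ∀ s ∈ X', ∀ z ∈ E, (s z).getD (Classical.arbitrary A) = a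

namespace Formula

/-- The conjunction of `φ` with the equations `z = c` for `z` in a list of variables. -/
def pin (c : L.Constants) (φ : Formula L) : List ℕ → Formula L
  | [] => φ
  | z :: E => conn .and (equal (Term.var z) c.term) (φ.pin c E)

theorem varFinset_constant (c : L.Constants) :
    (c.term : L.Term ℕ).varFinset = ∅ :=
  Finset.eq_empty_iff_forall_notMem.2 fun x hx => by
    obtain ⟨i, -, -⟩ := Finset.mem_biUnion.1 hx
    exact i.elim0

theorem freeVars_pin (c : L.Constants) (φ : Formula L) (E : List ℕ) :
    (φ.pin c E).freeVars = E.toFinset ∪ φ.freeVars := by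
  induction E with
  | nil => simp [pin]
  | cons z E ih => simp [pin, freeVars, ih, varFinset_constant, Term.varFinset]

theorem QuantifierFree.pin (c : L.Constants) {φ : Formula L} (h : φ.QuantifierFree)
    (E : List ℕ) : (φ.pin c E).QuantifierFree := by
  induction E with
  | nil => exact h
  | cons z E ih => exact ⟨trivial, ih⟩

theorem holds_pin {A : Type} [Nonempty A] [L.Structure A] (c : L.Constants) (φ : Formula L)
    (E : List ℕ) (s : Assignment A) :
    (φ.pin c E).Holds s ↔
      (∀ z ∈ E, (s z).getD (Classical.arbitrary A) = (c : A)) ∧ φ.Holds s := by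
  induction E with
  | nil => simp [Formula.pin]
  | cons z E ih =>
    simp [Formula.pin, Holds, ih, termValue, Term.realize_constants, and_assoc]

end Formula

theorem sat_conn_comm {A : Type} [Nonempty A] [L.Structure A] (c : Connective)
    (φ ψ : Formula L) (X : Set (Assignment A)) :
    Sat (.conn c φ ψ) true X ↔ Sat (.conn c ψ φ) true X := by
  cases c
  · exact and_comm
  · constructor <;>
    · rintro ⟨Y, Z, rfl, hY, hZ⟩
      exact ⟨Z, Y, Set.union_comm .., hZ, hY⟩

/-! ### Closure of translations under connectives and quantifiers -/

namespace Translates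

variable {A : Type} [Nonempty A] [L.Structure A] [L'.Structure A] {a : A}
  {D Z : Finset ℕ} {E : List ℕ} {φ φ' : Formula L} {ψ ψ' : Formula L'}

theorem swap {c : Connective} (h : Translates a D Z E φ (.conn c ψ ψ')) :
    Translates a D Z E φ (.conn c ψ' ψ) where
  sat_right X X' h1 h2 h3 := (sat_conn_comm ..).1 (h.sat_right X X' h1 h2 h3)
  sat_left X X' h1 h2 h3 := h.sat_left X X' h1 h2 ((sat_conn_comm ..).1 h3)
  pinned X' h1 := h.pinned X' ((sat_conn_comm ..).1 h1)

/-- At a gap everything is flat, so it suffices to look at single assignments; those that agree on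
`D` agree about `φ`. -/
theorem pin (g : L →ᴸ L') [g.IsExpansionOn A] (c : L'.Constants) (hφ : φ.QuantifierFree)
    (hD : φ.freeVars ⊆ D) (hZ : Disjoint D Z) :
    Translates (c : A) D Z E φ ((φ.onFormula g).pin c E) where
  sat_right X X' h1 h2 h3 := by
    rw [(((hφ.onFormula g).pin c E).sat_iff _).1]
    intro s hs
    rw [Formula.holds_pin, Formula.holds_onFormula]
    refine ⟨fun z hz => by rw [h2 s hs z hz]; rfl, ?_⟩
    refine (Formula.holds_congr fun x hx => ?_).1 ((hφ.sat_iff X).1.1 h3 _ (h1 s hs))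
    simp [Assignment.restrict, hD hx]
  sat_left X X' h1 h2 h3 := by
    rw [(hφ.sat_iff _).1]
    intro s hs
    have := (((hφ.onFormula g).pin c E).sat_iff _).1.1 h3 _ (h2 s hs)
    rw [Formula.holds_pin, Formula.holds_onFormula] at this
    refine (Formula.holds_congr fun x hx => ?_).1 this.2
    simp [Assignment.extend, Finset.disjoint_left.1 hZ (hD hx)]
  pinned X' h1 s hs :=
    ((Formula.holds_pin ..).1 ((((hφ.onFormula g).pin c E).sat_iff _).1.1 h1 s hs)).1

theorem and_right (h : Translates a D Z E φ ψ) (hψ' : ∀ X : Set (Assignment A), Sat ψ' true X) :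
    Translates a D Z E φ (.conn .and ψ ψ') where
  sat_right X X' h1 h2 h3 := ⟨h.sat_right X X' h1 h2 h3, hψ' _⟩
  sat_left X X' h1 h2 h3 := h.sat_left X X' h1 h2 h3.1
  pinned X' h1 := h.pinned X' h1.1

theorem or_right (h : Translates a D Z E φ ψ)
    (hψ' : ∀ X : Set (Assignment A), Sat ψ' true X → X = ∅) :
    Translates a D Z E φ (.conn .or ψ ψ') where
  sat_right X X' h1 h2 h3 :=
    ⟨X', ∅, Set.union_empty _, h.sat_right X X' h1 h2 h3, Formula.sat_empty _ _⟩
  sat_left X X' h1 h2 h3 := by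
    obtain ⟨Y, Y', rfl, hY, hY'⟩ := h3
    rw [hψ' _ hY', Set.union_empty] at h2
    exact h.sat_left X Y h1 h2 hY
  pinned X' h1 := by
    obtain ⟨Y, Y', rfl, hY, hY'⟩ := h1
    rw [hψ' _ hY', Set.union_empty]
    exact h.pinned Y hY

theorem conn (c : Connective) (h : Translates a D Z E φ ψ) (h' : Translates a D Z E φ' ψ') :
    Translates a D Z E (.conn c φ φ') (.conn c ψ ψ') := by
  cases c
  · exact
      { sat_right := fun X X' h1 h2 h3 =>
          ⟨h.sat_right X X' h1 h2 h3.1, h'.sat_right X X' h1 h2 h3.2⟩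
        sat_left := fun X X' h1 h2 h3 =>
          ⟨h.sat_left X X' h1 h2 h3.1, h'.sat_left X X' h1 h2 h3.2⟩
        pinned := fun X' h1 => h.pinned X' h1.1 }
  · constructor
    · rintro X X' h1 h2 ⟨Y, Y', rfl, hY, hY'⟩
      -- The split is pulled back along restriction; the next case pulls it back along extension.
      refine ⟨{s ∈ X' | s.restrict D ∈ Y}, {s ∈ X' | s.restrict D ∈ Y'}, ?_,
        h.sat_right Y _ (fun s hs => hs.2) (fun s hs => h2 s hs.1) hY,
        h'.sat_right Y' _ (fun s hs => hs.2) (fun s hs => h2 s hs.1) hY'⟩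
      ext s
      simpa [← and_or_left] using h1 s
    · rintro X X' h1 h2 ⟨Y, Y', rfl, hY, hY'⟩
      refine ⟨{s ∈ X | s.extend Z a ∈ Y}, {s ∈ X | s.extend Z a ∈ Y'}, ?_,
        h.sat_left _ Y (fun s hs => h1 s hs.1) (fun s hs => hs.2) hY,
        h'.sat_left _ Y' (fun s hs => h1 s hs.1) (fun s hs => hs.2) hY'⟩
      ext s
      simpa [← and_or_left] using h2 s
    · rintro X' ⟨Y, Y', rfl, hY, hY'⟩ s (hs | hs)
      exacts [h.pinned Y hY s hs, h'.pinned Y' hY' s hs]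

variable {v : ℕ} {V W : Finset ℕ}

/-- A universal dummy is invisible to `φ`; conversely, among all its values the duplicated team
contains `a`. -/
theorem quant_all_right (h : Translates a D (insert v Z) E φ ψ) (hD : v ∉ D) (hE : v ∉ E) :
    Translates a D Z E φ (.quant .all v V ψ) where
  sat_right X X' h1 h2 h3 := by
    refine h.sat_right X _ ?_ ?_ h3
    · rintro _ ⟨s, hs, b, rfl⟩
      rw [Assignment.restrict_set_of_notMem hD]
      exact h1 s hs
    · rintro _ ⟨s, hs, b, rfl⟩ z hz
      rw [Assignment.set_of_ne _ (ne_of_mem_of_not_mem hz hE)]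
      exact h2 s hs z hz
  sat_left X X' h1 h2 h3 :=
    h.sat_left X (duplicate X' v) h1 (fun s hs => ⟨_, h2 s hs, a, Assignment.extend_insert ..⟩) h3
  pinned X' h1 s hs z hz := by
    have := h.pinned _ h1 (s.set v a) ⟨s, hs, a, rfl⟩ z hz
    rwa [Assignment.set_of_ne _ (ne_of_mem_of_not_mem hz hE)] at this

/-- The constant choice `a` is uniform for every slash set, and `v :: E` in the hypothesis says that
no other choice is possible. -/
theorem quant_ex_right (h : Translates a D (insert v Z) (v :: E) φ ψ) (hD : v ∉ D) (hE : v ∉ E) :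
    Translates a D Z E φ (.quant .ex v V ψ) where
  sat_right X X' h1 h2 h3 := by
    refine ⟨fun _ => a, fun _ _ _ _ _ => rfl, h.sat_right X _ ?_ ?_ h3⟩
    · rintro _ ⟨s, hs, rfl⟩
      rw [Assignment.restrict_set_of_notMem hD]
      exact h1 s hs
    · rintro _ ⟨s, hs, rfl⟩ z hz
      obtain rfl | hz := List.mem_cons.1 hz
      · exact Assignment.set_self ..
      · rw [Assignment.set_of_ne _ (ne_of_mem_of_not_mem hz hE)]
        exact h2 s hs z hz
  sat_left X X' h1 h2 h3 := by
    obtain ⟨F, -, h3⟩ := h3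
    refine h.sat_left X (supplement X' F v) h1 (fun s hs => ⟨_, h2 s hs, ?_⟩) h3
    -- The formula below pins `v`, so the choice function returns `a`.
    have := h.pinned _ h3 ((s.extend Z a).set v (F _)) ⟨_, h2 s hs, rfl⟩ v List.mem_cons_self
    rw [Assignment.set_self] at this
    rw [Assignment.extend_insert, show F _ = a from this]
  pinned X' h1 s hs z hz := by
    obtain ⟨F, -, h1⟩ := h1
    have := h.pinned _ h1 (s.set v (F s)) ⟨s, hs, rfl⟩ z (List.mem_cons_of_mem _ hz)
    rwa [Assignment.set_of_ne _ (ne_of_mem_of_not_mem hz hE)] at this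

theorem quant_all (h : Translates a (insert v D) Z E φ ψ) (hZ : v ∉ Z) (hE : v ∉ E) :
    Translates a D Z E (.quant .all v V φ) (.quant .all v W ψ) where
  sat_right X X' h1 h2 h3 := by
    refine h.sat_right _ _ ?_ ?_ h3
    · rintro _ ⟨s, hs, b, rfl⟩
      exact ⟨_, h1 s hs, b, Assignment.restrict_insert_set ..⟩
    · rintro _ ⟨s, hs, b, rfl⟩ z hz
      rw [Assignment.set_of_ne _ (ne_of_mem_of_not_mem hz hE)]
      exact h2 s hs z hz
  sat_left X X' h1 h2 h3 := by
    refine h.sat_left _ _ ?_ ?_ h3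
    · rintro _ ⟨s, hs, b, rfl⟩
      exact Assignment.mem_of_set_ne_none (h1 s hs) b
    · rintro _ ⟨s, hs, b, rfl⟩
      exact ⟨_, h2 s hs, b, Assignment.extend_set_of_notMem hZ ..⟩
  pinned X' h1 s hs z hz := by
    have := h.pinned _ h1 (s.set v a) ⟨s, hs, a, rfl⟩ z hz
    rwa [Assignment.set_of_ne _ (ne_of_mem_of_not_mem hz hE)] at this

/-- Choice functions are transported by forgetting the dummies in one direction and by setting them
to `a` in the other. Uniformity survives because `V` and `W` agree on `D` and the dummies, all equal
to `a`, distinguish no assignments. -/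
theorem quant_ex (h : Translates a (insert v D) Z E φ ψ) (hZ : v ∉ Z) (hE : v ∉ E)
    (hVW : ∀ x ∈ D, x ∈ V ↔ x ∈ W) :
    Translates a D Z E (.quant .ex v V φ) (.quant .ex v W ψ) where
  sat_right X X' h1 h2 h3 := by
    obtain ⟨F, hF, h3⟩ := h3
    refine ⟨fun s => F (s.restrict D), fun s hs t ht hst => hF _ (h1 s hs) _ (h1 t ht) ?_,
      h.sat_right _ _ ?_ ?_ h3⟩
    · intro x hx hxV
      by_cases hxD : x ∈ D
      · simp only [Assignment.restrict, hxD, if_true] at hx ⊢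
        exact hst x hx (mt (hVW x hxD).2 hxV)
      · simp [Assignment.restrict, hxD] at hx
    · rintro _ ⟨s, hs, rfl⟩
      exact ⟨_, h1 s hs, Assignment.restrict_insert_set ..⟩
    · rintro _ ⟨s, hs, rfl⟩ z hz
      rw [Assignment.set_of_ne _ (ne_of_mem_of_not_mem hz hE)]
      exact h2 s hs z hz
  sat_left X X' h1 h2 h3 := by
    obtain ⟨F, hF, h3⟩ := h3
    refine ⟨fun s => F (s.extend Z a), fun s hs t ht hst => hF _ (h2 s hs) _ (h2 t ht) ?_,
      h.sat_left _ _ ?_ ?_ h3⟩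
    · intro x hx hxW
      by_cases hxZ : x ∈ Z
      · simp [Assignment.extend, hxZ]
      · simp only [Assignment.extend, hxZ, if_false] at hx ⊢
        exact hst x hx (mt (hVW x (h1 s hs x hx)).1 hxW)
    · rintro _ ⟨s, hs, rfl⟩
      exact Assignment.mem_of_set_ne_none (h1 s hs) _
    · rintro _ ⟨s, hs, rfl⟩
      exact ⟨_, h2 s hs, Assignment.extend_set_of_notMem hZ ..⟩
  pinned X' h1 s hs z hz := by
    obtain ⟨F, -, h1⟩ := h1
    have := h.pinned _ h1 (s.set v (F s)) ⟨s, hs, rfl⟩ z hz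
    rwa [Assignment.set_of_ne _ (ne_of_mem_of_not_mem hz hE)] at this

end Translates

namespace PosTree

/-! ### Embeddings of trees -/

/-- `Embeds D Z U T`: the tree `T` arises from `U` by deleting quantifiers and connectives (the
latter together with one of their branches), by exchanging the branches below connectives, and by
changing the slash sets, where no change is made to the dependence on the variables in `D`. No
quantified variable of the part of `U` that is relevant to `T` is in `D ∪ Z` or quantified
repeatedly. -/
inductive Embeds : Finset ℕ → Finset ℕ → PosTree → PosTree → Prop
  | gap (D Z : Finset ℕ) : Embeds D Z gap gap
  | skip_right {D Z : Finset ℕ} {l T : PosTree} (c : Connective) (r : PosTree)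
      (h : Embeds D Z l T) : Embeds D Z (conn c l r) T
  | skip_left {D Z : Finset ℕ} {r T : PosTree} (c : Connective) (l : PosTree)
      (h : Embeds D Z r T) : Embeds D Z (conn c l r) T
  | skip_quant {D Z : Finset ℕ} {t T : PosTree} (q : Quantifier) {v : ℕ} (V : Finset ℕ)
      (hD : v ∉ D) (hZ : v ∉ Z) (h : Embeds D (insert v Z) t T) : Embeds D Z (quant q v V t) T
  | conn {D Z : Finset ℕ} {l r l' r' : PosTree} (c : Connective)
      (h : Embeds D Z l l') (h' : Embeds D Z r r') : Embeds D Z (conn c l r) (conn c l' r')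
  | conn_swap {D Z : Finset ℕ} {l r l' r' : PosTree} (c : Connective)
      (h : Embeds D Z l r') (h' : Embeds D Z r l') : Embeds D Z (conn c l r) (conn c l' r')
  | quant {D Z : Finset ℕ} {t t' : PosTree} (q : Quantifier) {v : ℕ} {W V : Finset ℕ}
      (hZ : v ∉ Z) (hVW : ∀ x ∈ D, x ∈ V ↔ x ∈ W) (h : Embeds (insert v D) Z t t') :
      Embeds D Z (quant q v W t) (quant q v V t')

/-- The sum of two completing functions. -/
def Path.connElim {α : Type} {c : Connective} {l r : PosTree} (e : Path l → α) (e' : Path r → α) :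
    Path (conn c l r) → α
  | .left p => e p
  | .right p => e' p

/-- The completing function above a quantifier. -/
def Path.quantElim {α : Type} {q : Quantifier} {v : ℕ} {V : Finset ℕ} {t : PosTree}
    (e : Path t → α) : Path (quant q v V t) → α
  | .under p => e p

theorem Path.forall_conn {c : Connective} {l r : PosTree} {P : Path (PosTree.conn c l r) → Prop}
    (hl : ∀ p, P (.left p)) (hr : ∀ p, P (.right p)) (p) : P p := by
  cases p with
  | left p => exact hl p
  | right p => exact hr p

theorem Path.forall_quant {q : Quantifier} {v : ℕ} {V : Finset ℕ} {t : PosTree}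
    {P : Path (PosTree.quant q v V t) → Prop} (h : ∀ p, P (.under p)) (p) : P p := by
  cases p with
  | under p => exact h p

/-- A completing function of `U` that translates the completing function `e` of `T`. -/
def IsTranslation (g : L →ᴸ L') (k : L'.Constants) (D Z : Finset ℕ) (E : List ℕ) {U T : PosTree}
    (e : Path T → Formula L) (e' : Path U → Formula L') : Prop :=
  Weak e' ∧ (∀ p, (e' p).freeVars ⊆ D ∪ Z ∪ p.boundVars) ∧
    ∀ (A : Type) [Nonempty A] [L.Structure A] [L'.Structure A] [g.IsExpansionOn A],
      Translates (k : A) D Z E (T.complete e) (U.complete e')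

/-- A quantifier-free sentence that makes a branch of a connective irrelevant. -/
def neutral (k : L.Constants) : Connective → Formula L
  | .and => .equal k.term k.term
  | .or => .neg (.equal k.term k.term)

theorem freeVars_neutral (k : L.Constants) (c : Connective) : (neutral k c).freeVars = ∅ := by
  cases c <;> simp [neutral, Formula.freeVars, Formula.varFinset_constant]

theorem quantifierFree_neutral (k : L.Constants) (c : Connective) :
    (neutral k c).QuantifierFree := by
  cases c <;> trivial

theorem translates_conn_neutral {A : Type} [Nonempty A] [L.Structure A] [L'.Structure A] {a : A}
    {D Z : Finset ℕ} {E : List ℕ} {φ : Formula L} {ψ : Formula L'} (k : L'.Constants)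
    (c : Connective) (T : PosTree) (h : Translates a D Z E φ ψ) :
    Translates a D Z E φ (.conn c ψ (T.complete fun _ => neutral k c)) := by
  cases c
  · have hk (X : Set (Assignment A)) : Sat (neutral k .and) true X := by
      intro s _
      rfl
    exact h.and_right (sat_complete_of_forall hk T)
  · have hk (X : Set (Assignment A)) (hX : Sat (neutral k .or) true X) : X = ∅ := by
      simpa [neutral, Sat, Set.eq_empty_iff_forall_notMem] using hX
    exact h.or_right (eq_empty_of_sat_complete hk T)

/-- `Z` collects all dummies passed so far and `E` the existential ones among them, which the gaps
must pin. The result is uniform in the structure, as one completing function has to serve all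
models. -/
theorem Embeds.exists_isTranslation {D Z : Finset ℕ} {U T : PosTree} (h : Embeds D Z U T)
    (g : L →ᴸ L') (k : L'.Constants) (hDZ : Disjoint D Z) {E : List ℕ} (hE : ∀ z ∈ E, z ∈ Z)
    {e : Path T → Formula L} (he : Weak e) (hfv : ∀ p, (e p).freeVars ⊆ D ∪ p.boundVars) :
    ∃ e' : Path U → Formula L', IsTranslation g k D Z E e e' := by
  induction h generalizing E with
  | gap D Z =>
    have hD : (e .gap).freeVars ⊆ D := by simpa [Path.boundVars] using hfv .gap
    refine ⟨fun _ => ((e .gap).onFormula g).pin k E, fun p => ((he _).onFormula g).pin k E,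
      fun p => ?_, fun A _ _ _ _ => .pin g k (he _) hD hDZ⟩
    rw [Formula.freeVars_pin, Formula.freeVars_onFormula]
    intro x hx
    simp only [Finset.mem_union, List.mem_toFinset] at hx ⊢
    exact .inl (hx.symm.imp (@hD x) (hE x))
  | skip_right c r h ih =>
    obtain ⟨e', h1, h2, h3⟩ := ih hDZ hE he hfv
    refine ⟨Path.connElim e' fun _ => neutral k c, ?_, ?_,
      fun A _ _ _ _ => translates_conn_neutral k c r (h3 A)⟩
    · refine Path.forall_conn (fun p => ?_) fun p => ?_
      exacts [h1 p, quantifierFree_neutral k c]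
    · refine Path.forall_conn (fun p => ?_) fun p => ?_
      exacts [h2 p, (freeVars_neutral k c).trans_subset (Finset.empty_subset _)]
  | skip_left c l h ih =>
    obtain ⟨e', h1, h2, h3⟩ := ih hDZ hE he hfv
    refine ⟨Path.connElim (fun _ => neutral k c) e', ?_, ?_,
      fun A _ _ _ _ => (translates_conn_neutral k c l (h3 A)).swap⟩
    · refine Path.forall_conn (fun p => ?_) fun p => ?_
      exacts [quantifierFree_neutral k c, h1 p]
    · refine Path.forall_conn (fun p => ?_) fun p => ?_
      exacts [(freeVars_neutral k c).trans_subset (Finset.empty_subset _), h2 p]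
  | @skip_quant D Z t T q v V hD hZ h ih =>
    have hDZ' : Disjoint D (insert v Z) := Finset.disjoint_insert_right.2 ⟨hD, hDZ⟩
    have hvE : v ∉ E := fun hv => hZ (hE v hv)
    have hE' : ∀ z ∈ E, z ∈ insert v Z := fun z hz => Finset.mem_insert_of_mem (hE z hz)
    have key (e' : Path t → Formula L')
        (h2 : ∀ p, (e' p).freeVars ⊆ D ∪ insert v Z ∪ p.boundVars)
        (p : Path (PosTree.quant q v V t)) :
        (Path.quantElim e' p).freeVars ⊆ D ∪ Z ∪ p.boundVars := by
      cases p with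
      | under p =>
        refine (h2 p).trans ?_
        intro x
        simp only [Path.boundVars, Finset.mem_union, Finset.mem_insert]
        tauto
    -- A universal dummy takes all values and must not be pinned; an existential one joins `E`.
    cases q
    · obtain ⟨e', h1, h2, h3⟩ := ih hDZ' hE' he hfv
      exact ⟨Path.quantElim e', Path.forall_quant h1, key e' h2,
        fun A _ _ _ _ => (h3 A).quant_all_right hD hvE⟩
    · obtain ⟨e', h1, h2, h3⟩ := ih hDZ' (E := v :: E)
        (List.forall_mem_cons.2 ⟨Finset.mem_insert_self .., hE'⟩) he hfv
      exact ⟨Path.quantElim e', Path.forall_quant h1, key e' h2,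
        fun A _ _ _ _ => (h3 A).quant_ex_right hD hvE⟩
  | conn c h h' ih ih' =>
    obtain ⟨e₁, h1, h2, h3⟩ := ih hDZ hE (fun p => he (.left p)) fun p => hfv (.left p)
    obtain ⟨e₂, h4, h5, h6⟩ := ih' hDZ hE (fun p => he (.right p)) fun p => hfv (.right p)
    refine ⟨Path.connElim e₁ e₂, ?_, ?_, fun A _ _ _ _ => (h3 A).conn c (h6 A)⟩
    · refine Path.forall_conn (fun p => ?_) fun p => ?_
      exacts [h1 p, h4 p]
    · refine Path.forall_conn (fun p => ?_) fun p => ?_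
      exacts [h2 p, h5 p]
  | conn_swap c h h' ih ih' =>
    obtain ⟨e₁, h1, h2, h3⟩ := ih hDZ hE (fun p => he (.right p)) fun p => hfv (.right p)
    obtain ⟨e₂, h4, h5, h6⟩ := ih' hDZ hE (fun p => he (.left p)) fun p => hfv (.left p)
    refine ⟨Path.connElim e₁ e₂, ?_, ?_, fun A _ _ _ _ => ((h6 A).conn c (h3 A)).swap⟩
    · refine Path.forall_conn (fun p => ?_) fun p => ?_
      exacts [h1 p, h4 p]
    · refine Path.forall_conn (fun p => ?_) fun p => ?_
      exacts [h2 p, h5 p]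
  | @quant D Z t t' q v W V hZ hVW h ih =>
    have hvE : v ∉ E := fun hv => hZ (hE v hv)
    have hins (S S' : Finset ℕ) : insert v S ∪ S' = S ∪ insert v S' := by
      rw [Finset.insert_union, Finset.union_insert]
    obtain ⟨e', h1, h2, h3⟩ := ih (Finset.disjoint_insert_left.2 ⟨hZ, hDZ⟩) hE
      (fun p => he (.under p)) fun p => (hfv (.under p)).trans (hins ..).superset
    refine ⟨Path.quantElim e', Path.forall_quant h1, ?_, fun A _ _ _ _ => ?_⟩
    · refine Path.forall_quant fun p => ?_
      refine (h2 p).trans ?_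
      rw [Finset.insert_union, hins]
      exact subset_rfl
    · cases q
      exacts [(h3 A).quant_all hZ hvE, (h3 A).quant_ex hZ hvE hVW]

/-! ### Extensions of trees are embeddings -/

theorem prec_left_iff {c : Connective} {l r : PosTree} {m n : Node l} :
    Prec (Node.left (c := c) (r := r) m) (Node.left n) ↔ Prec m n :=
  ⟨fun h => by cases h; assumption, .left⟩

theorem prec_right_iff {c : Connective} {l r : PosTree} {m n : Node r} :
    Prec (Node.right (c := c) (l := l) m) (Node.right n) ↔ Prec m n :=
  ⟨fun h => by cases h; assumption, .right⟩

theorem prec_under_iff {q : Quantifier} {v : ℕ} {V : Finset ℕ} {t : PosTree} {m n : Node t} :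
    Prec (Node.under (q := q) (v := v) (V := V) m) (Node.under n) ↔ Prec m n :=
  ⟨fun h => by cases h; assumption, .under⟩

/-- An inclusion of a subtree. -/
structure IsInclusion {S T : PosTree} (i : Node S → Node T) : Prop where
  injective : Function.Injective i
  label_eq : ∀ n, (i n).label = n.label
  prec_iff : ∀ m n, Prec (i m) (i n) ↔ Prec m n
  mem_range : ∀ m n, Prec (i m) n → n ∈ Set.range i

theorem IsInclusion.id (T : PosTree) : IsInclusion (id : Node T → Node T) :=
  ⟨Function.injective_id, fun _ => rfl, fun _ _ => Iff.rfl, fun _ n _ => ⟨n, rfl⟩⟩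

theorem isInclusion_left (c : Connective) (l r : PosTree) :
    IsInclusion (Node.left (c := c) (l := l) (r := r)) where
  injective _ _ h := by cases h; rfl
  label_eq _ := rfl
  prec_iff _ _ := prec_left_iff
  mem_range m n h := by cases h; exact ⟨_, rfl⟩

theorem isInclusion_right (c : Connective) (l r : PosTree) :
    IsInclusion (Node.right (c := c) (l := l) (r := r)) where
  injective _ _ h := by cases h; rfl
  label_eq _ := rfl
  prec_iff _ _ := prec_right_iff
  mem_range m n h := by cases h; exact ⟨_, rfl⟩

theorem isInclusion_under (q : Quantifier) (v : ℕ) (V : Finset ℕ) (t : PosTree) :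
    IsInclusion (Node.under (q := q) (v := v) (V := V) (t := t)) where
  injective _ _ h := by cases h; rfl
  label_eq _ := rfl
  prec_iff _ _ := prec_under_iff
  mem_range m n h := by cases h; exact ⟨_, rfl⟩

/-- A node that separates nothing must lie below `i c`, hence inside the subtree, because the range
is closed under subordination. -/
theorem IsInclusion.inDifferentBranches_iff {S T : PosTree} {i : Node S → Node T}
    (h : IsInclusion i) (c m n : Node S) :
    InDifferentBranches (i c) (i m) (i n) ↔ InDifferentBranches c m n := by
  simp only [InDifferentBranches, h.prec_iff]
  refine and_congr_right fun _ => and_congr_right fun _ => not_congr ?_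
  constructor
  · rintro ⟨d, h1, h2, h3⟩
    obtain ⟨d, rfl⟩ := h.mem_range _ _ h1
    rw [h.prec_iff] at h1 h2 h3
    exact ⟨d, h1, h2.imp_left fun h' => h.injective h', h3.imp_left fun h' => h.injective h'⟩
  · rintro ⟨d, h1, h2, h3⟩
    refine ⟨i d, (h.prec_iff ..).2 h1, ?_, ?_⟩
    · rw [h.prec_iff]; exact h2.imp_left fun h' => congrArg i h'
    · rw [h.prec_iff]; exact h3.imp_left fun h' => congrArg i h'

theorem IsInclusion.dependsOn_iff {S T : PosTree} {i : Node S → Node T} (h : IsInclusion i)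
    (m n : Node S) : DependsOn (i n) (i m) ↔ DependsOn n m := by
  simp only [DependsOn, h.prec_iff, h.label_eq]

/-- The map `μ` is as in the definition of `Extends`, and moreover the slash sets agree on `D`. -/
structure IsExtensionMap (D : Finset ℕ) {T U : PosTree} (μ : Node T → Node U) : Prop where
  label_quant : ∀ n q v V, n.label = .quant q v V →
    ∃ V', (μ n).label = .quant q v V' ∧ ∀ x ∈ D, x ∈ V ↔ x ∈ V'
  label_conn : ∀ n c, n.label = .conn c → (μ n).label = .conn c
  prec : ∀ m n, Prec m n → Prec (μ m) (μ n)
  branches : ∀ c m n, InDifferentBranches c m n → InDifferentBranches (μ c) (μ m) (μ n)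
  dependsOn : ∀ m n, DependsOn n m ↔ DependsOn (μ n) (μ m)

variable {D : Finset ℕ}

theorem IsExtensionMap.restrict {S T U U' : PosTree} {μ : Node T → Node U}
    (h : IsExtensionMap D μ) {i : Node S → Node T} (hi : IsInclusion i) {j : Node U' → Node U}
    (hj : IsInclusion j) {μ' : Node S → Node U'} (hμ : ∀ n, μ (i n) = j (μ' n)) :
    IsExtensionMap D μ' where
  label_quant n q v V hn := by
    rw [← hj.label_eq, ← hμ]
    exact h.label_quant _ q v V (by rw [hi.label_eq, hn])
  label_conn n c hn := by
    rw [← hj.label_eq, ← hμ]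
    exact h.label_conn _ c (by rw [hi.label_eq, hn])
  prec m n hmn := by
    rw [← hj.prec_iff, ← hμ, ← hμ]
    exact h.prec _ _ ((hi.prec_iff ..).2 hmn)
  branches c m n hc := by
    rw [← hj.inDifferentBranches_iff, ← hμ, ← hμ, ← hμ]
    exact h.branches _ _ _ ((hi.inDifferentBranches_iff ..).2 hc)
  dependsOn m n := by
    rw [← hj.dependsOn_iff, ← hμ, ← hμ, ← hi.dependsOn_iff]
    exact h.dependsOn _ _

theorem IsExtensionMap.exists_restrict {S T U U' : PosTree} {μ : Node T → Node U}
    (h : IsExtensionMap D μ) {i : Node S → Node T} (hi : IsInclusion i) {j : Node U' → Node U}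
    (hj : IsInclusion j) (hμ : ∀ n, μ (i n) ∈ Set.range j) :
    ∃ μ' : Node S → Node U', IsExtensionMap D μ' ∧ ∀ n, j (μ' n) = μ (i n) := by
  choose μ' hμ' using hμ
  exact ⟨μ', h.restrict hi hj fun n => (hμ' n).symm, hμ'⟩

/-- A nonempty tree has a node that is superordinated to all others. -/
theorem exists_root {T : PosTree} (h : T ≠ gap) : ∃ ρ : Node T, ∀ n, n = ρ ∨ Prec ρ n := by
  cases T with
  | gap => exact absurd rfl h
  | conn c l r =>
    refine ⟨.connRoot, fun n => ?_⟩
    cases n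
    exacts [.inl rfl, .inr (.root_left _), .inr (.root_right _)]
  | quant q v V t =>
    refine ⟨.quantRoot, fun n => ?_⟩
    cases n
    exacts [.inl rfl, .inr (.root_under _)]

/-- The image of the root decides: a subtree contains everything subordinated to one of its nodes.
-/
theorem IsExtensionMap.forall_mem_range {T U U' : PosTree} {μ : Node T → Node U}
    (h : IsExtensionMap D μ) {j : Node U' → Node U} (hj : IsInclusion j) {ρ : Node T}
    (hρ : ∀ n, n = ρ ∨ Prec ρ n) (hμ : μ ρ ∈ Set.range j) (n : Node T) : μ n ∈ Set.range j := by
  obtain rfl | hn := hρ n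
  · exact hμ
  · obtain ⟨a, ha⟩ := hμ
    exact hj.mem_range a _ (ha ▸ h.prec _ _ hn)

theorem inDifferentBranches_left_right {c : Connective} {l r : PosTree} (m : Node l)
    (n : Node r) : InDifferentBranches (Node.connRoot (c := c)) (.left m) (.right n) := by
  refine ⟨.root_left _, .root_right _, ?_⟩
  rintro ⟨d, h1, h2, h3⟩
  cases h1
  · obtain h3 | h3 := h3 <;> cases h3
  · obtain h2 | h2 := h2 <;> cases h2

/-- The root of the subtree lies below `c` and is superordinated or equal to both nodes. -/
theorem not_inDifferentBranches_of_mem_range {S T : PosTree} {j : Node S → Node T}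
    (hj : IsInclusion j) {c : Node T} (hc : ∀ n, Prec c (j n)) {m n : Node T}
    (hm : m ∈ Set.range j) (hn : n ∈ Set.range j) : ¬ InDifferentBranches c m n := by
  obtain ⟨m, rfl⟩ := hm
  obtain ⟨n, rfl⟩ := hn
  rintro ⟨-, -, h⟩
  have hS : S ≠ gap := by rintro rfl; cases m
  obtain ⟨ρ, hρ⟩ := exists_root hS
  refine h ⟨j ρ, hc ρ, (hρ m).imp (fun h' => congrArg j h'.symm) (hj.prec_iff ..).2,
    (hρ n).imp (fun h' => congrArg j h'.symm) (hj.prec_iff ..).2⟩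

theorem mem_range_left_or_right {c : Connective} {l r : PosTree} {n : Node (conn c l r)}
    (h : Prec Node.connRoot n) : n ∈ Set.range Node.left ∨ n ∈ Set.range Node.right := by
  cases h
  exacts [.inl ⟨_, rfl⟩, .inr ⟨_, rfl⟩]

/-- If the root of a binary tree is mapped to the root of a binary tree, then the branches are
mapped into different branches. -/
theorem IsExtensionMap.branches_cases {c c' : Connective} {l r l' r' : PosTree}
    {μ : Node (conn c' l' r') → Node (conn c l r)} (h : IsExtensionMap D μ)
    (hμ : μ .connRoot = .connRoot) :
    ((∀ n, μ (.left n) ∈ Set.range Node.left) ∧ ∀ n, μ (.right n) ∈ Set.range Node.right) ∨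
    ((∀ n, μ (.left n) ∈ Set.range Node.right) ∧ ∀ n, μ (.right n) ∈ Set.range Node.left) := by
  have hl (n) : μ (.left n) ∈ Set.range Node.left ∨ μ (.left n) ∈ Set.range Node.right :=
    mem_range_left_or_right (hμ ▸ h.prec _ _ (.root_left n))
  have hr (n) : μ (.right n) ∈ Set.range Node.left ∨ μ (.right n) ∈ Set.range Node.right :=
    mem_range_left_or_right (hμ ▸ h.prec _ _ (.root_right n))
  have hb (m n) := hμ ▸ h.branches _ _ _ (inDifferentBranches_left_right m n)
  have hnl {m n} (hm) (hn) (hb) := not_inDifferentBranches_of_mem_range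
    (isInclusion_left c l r) .root_left (m := m) (n := n) hm hn hb
  have hnr {m n} (hm) (hn) (hb) := not_inDifferentBranches_of_mem_range
    (isInclusion_right c l r) .root_right (m := m) (n := n) hm hn hb
  have conn_left {S : PosTree} {i : Node S → Node (conn c' l' r')} (hi : IsInclusion i)
      (hS : S ≠ gap) (hi' : ∀ n, μ (i n) ∈ Set.range Node.left ∨ μ (i n) ∈ Set.range Node.right) :
      (∀ n, μ (i n) ∈ Set.range Node.left) ∨ ∀ n, μ (i n) ∈ Set.range Node.right := by
    obtain ⟨ρ, hρ⟩ := exists_root hS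
    have hμi : IsExtensionMap D (μ ∘ i) := h.restrict hi (.id _) fun _ => rfl
    exact (hi' ρ).imp (hμi.forall_mem_range (isInclusion_left c l r) hρ)
      (hμi.forall_mem_range (isInclusion_right c l r) hρ)
  -- An empty branch imposes nothing, so the other branch alone determines the side. If the left
  -- branch is nonempty, the image of its root forces every node of the right one to the opposite
  -- side.
  by_cases hl' : l' = gap
  · subst hl'
    by_cases hr' : r' = gap
    · subst hr'
      exact .inl ⟨nofun, nofun⟩
    · obtain h' | h' := conn_left (isInclusion_right ..) hr' hr
      exacts [.inr ⟨nofun, h'⟩, .inl ⟨nofun, h'⟩]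
  · obtain ⟨ρ, -⟩ := exists_root hl'
    obtain h' | h' := conn_left (isInclusion_left ..) hl' hl
    · exact .inl ⟨h', fun n => (hr n).resolve_left fun hn => hnl (h' ρ) hn (hb ρ n)⟩
    · exact .inr ⟨h', fun n => (hr n).resolve_right fun hn => hnr (h' ρ) hn (hb ρ n)⟩

/-- If the root of a quantified tree is mapped to the root of a quantified tree, then the slash
sets below agree on the quantified variable. -/
theorem IsExtensionMap.exists_restrict_under {q : Quantifier} {v : ℕ} {V W : Finset ℕ}
    {t t' : PosTree} {μ : Node (quant q v V t') → Node (quant q v W t)}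
    (h : IsExtensionMap D μ) (hμ : μ .quantRoot = .quantRoot) :
    ∃ μ' : Node t' → Node t, IsExtensionMap (insert v D) μ' := by
  have hr (n) : μ (.under n) ∈ Set.range Node.under := by
    have := hμ ▸ h.prec _ _ (.root_under n)
    generalize μ (.under n) = x at this
    cases this
    exact ⟨_, rfl⟩
  obtain ⟨μ', h', hμ'⟩ := h.exists_restrict (isInclusion_under ..) (isInclusion_under ..) hr
  refine ⟨μ', { h' with label_quant := fun n q' w V₁ hn => ?_ }⟩
  obtain ⟨V₂, hn', hV⟩ := h'.label_quant n q' w V₁ hn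
  refine ⟨V₂, hn', Finset.forall_mem_insert _ _ _ |>.2 ⟨?_, hV⟩⟩
  -- Below the root quantifier, dependence on it just means that its variable is not slashed.
  -- Preservation of dependence therefore adds `v` to the set on which slash sets agree.
  have hdep {V S} {s : PosTree} {n : Node s} (hn : n.label = .quant q' w S) :
      DependsOn (Node.under n) (Node.quantRoot (q := q) (v := v) (V := V)) ↔ v ∉ S := by
    constructor
    · rintro ⟨_, _, _, _, _, _, hl, hl', -, hv⟩
      cases hl
      cases hn.symm.trans hl'
      exact hv
    · exact fun hv => ⟨_, _, _, _, _, _, rfl, hn, .root_under n, hv⟩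
  have := h.dependsOn .quantRoot (.under n)
  rw [hμ, ← hμ' n, hdep hn, hdep hn'] at this
  exact not_iff_not.1 this

/-- No quantified variable of the tree is in `B` or quantified above. -/
def Fresh : Finset ℕ → PosTree → Prop
  | _, gap => True
  | B, conn _ l r => Fresh B l ∧ Fresh B r
  | B, quant _ v _ t => v ∉ B ∧ Fresh (insert v B) t

/-- All of `U` is superfluous; at connectives the left branch is kept arbitrarily. -/
theorem Fresh.embeds_gap {D Z : Finset ℕ} {U : PosTree} (h : Fresh (D ∪ Z) U) :
    Embeds D Z U gap := by
  induction U generalizing Z with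
  | gap => exact .gap D Z
  | conn c l r ihl _ => exact .skip_right c r (ihl h.1)
  | quant q v V t ih =>
    obtain ⟨hD, hZ⟩ := Finset.notMem_union.1 h.1
    exact .skip_quant q V hD hZ (ih (Finset.union_insert v D Z ▸ h.2))

/-- If the root of `T` goes to the root of `U`, the two operators match and the map restricts to the
parts below. Otherwise all of `T` lands strictly below, in a single branch, and the root of `U` is
skipped. The set `D` remembers dependences on quantifiers already removed. -/
theorem IsExtensionMap.embeds {D Z : Finset ℕ} {T U : PosTree} {μ : Node T → Node U}
    (h : IsExtensionMap D μ) (hU : Fresh (D ∪ Z) U) : Embeds D Z U T := by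
  induction U generalizing T D Z with
  | gap =>
    by_cases hT : T = gap
    · exact hT ▸ .gap D Z
    · obtain ⟨ρ, -⟩ := exists_root hT
      exact nomatch μ ρ
  | conn c l r ihl ihr =>
    by_cases hT : T = gap
    · exact hT ▸ hU.embeds_gap
    obtain ⟨ρ, hρ⟩ := exists_root hT
    rcases hμ : μ ρ with _ | a | a
    · cases T with
      | gap => exact absurd rfl hT
      | quant q v V t =>
        obtain rfl | hn := hρ .quantRoot
        · obtain ⟨V', hl, -⟩ := h.label_quant .quantRoot q v V rfl
          rw [hμ] at hl
          cases hl
        · cases hn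
      | conn c' l' r' =>
        obtain rfl | hn := hρ .connRoot
        · have hl := h.label_conn .connRoot c' rfl
          rw [hμ] at hl
          cases hl
          obtain ⟨h1, h2⟩ | ⟨h1, h2⟩ := h.branches_cases hμ
          · obtain ⟨μ₁, h1, -⟩ := h.exists_restrict (isInclusion_left ..) (isInclusion_left ..) h1
            obtain ⟨μ₂, h2, -⟩ := h.exists_restrict (isInclusion_right ..) (isInclusion_right ..) h2
            exact .conn c (ihl h1 hU.1) (ihr h2 hU.2)
          · obtain ⟨μ₁, h1, -⟩ := h.exists_restrict (isInclusion_left ..) (isInclusion_right ..) h1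
            obtain ⟨μ₂, h2, -⟩ := h.exists_restrict (isInclusion_right ..) (isInclusion_left ..) h2
            exact .conn_swap c (ihl h2 hU.1) (ihr h1 hU.2)
        · cases hn
    · obtain ⟨μ', h', -⟩ := h.exists_restrict (.id _) (isInclusion_left c l r)
        (h.forall_mem_range (isInclusion_left c l r) hρ ⟨a, hμ.symm⟩)
      exact .skip_right c r (ihl h' hU.1)
    · obtain ⟨μ', h', -⟩ := h.exists_restrict (.id _) (isInclusion_right c l r)
        (h.forall_mem_range (isInclusion_right c l r) hρ ⟨a, hμ.symm⟩)
      exact .skip_left c l (ihr h' hU.2)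
  | quant q v W t ih =>
    by_cases hT : T = gap
    · exact hT ▸ hU.embeds_gap
    obtain ⟨ρ, hρ⟩ := exists_root hT
    obtain ⟨hD, hZ⟩ := Finset.notMem_union.1 hU.1
    cases hμ : μ ρ with
    | quantRoot =>
      cases T with
      | gap => exact absurd rfl hT
      | conn c l r =>
        obtain rfl | hn := hρ .connRoot
        · have hl := h.label_conn .connRoot c rfl
          rw [hμ] at hl
          cases hl
        · cases hn
      | quant q' v' V t' =>
        obtain rfl | hn := hρ .quantRoot
        · obtain ⟨V', hl, hV⟩ := h.label_quant .quantRoot q' v' V rfl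
          rw [hμ] at hl
          cases hl
          obtain ⟨μ', h'⟩ := h.exists_restrict_under hμ
          exact .quant q hZ hV (ih h' (Finset.insert_union v D Z ▸ hU.2))
        · cases hn
    | under a =>
      obtain ⟨μ', h', -⟩ := h.exists_restrict (.id _) (isInclusion_under q v W t)
        (h.forall_mem_range (isInclusion_under q v W t) hρ ⟨a, hμ.symm⟩)
      exact .skip_quant q W hD hZ (ih h' (Finset.union_insert v D Z ▸ hU.2))

theorem fresh_of_forall {B : Finset ℕ} {T : PosTree}
    (hB : ∀ n : Node T, ∀ q v V, n.label = .quant q v V → v ∉ B)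
    (h : ∀ m n : Node T, Prec m n → ∀ q v V q' w W,
      m.label = .quant q v V → n.label = .quant q' w W → v ≠ w) : Fresh B T := by
  induction T generalizing B with
  | gap => trivial
  | conn c l r ihl ihr =>
    exact ⟨ihl (fun n => hB (.left n)) fun m n hmn => h _ _ (.left hmn),
      ihr (fun n => hB (.right n)) fun m n hmn => h _ _ (.right hmn)⟩
  | quant q v V t ih =>
    refine ⟨hB .quantRoot q v V rfl, ih (fun n q' w W hn hw => ?_)
      fun m n hmn => h _ _ (.under hmn)⟩
    obtain rfl | hw := Finset.mem_insert.1 hw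
    · exact h _ _ (.root_under n) q w V q' w W rfl hn rfl
    · exact hB (.under n) q' w W hn hw

/-! ### Transfer of hardness -/

theorem Extends.embeds {T U : PosTree} (hU : U.Regular) (hUT : U.Extends T) :
    Embeds ∅ ∅ U T := by
  obtain ⟨μ, -, hq, hc, hp, hb, hd⟩ := hUT
  have h : IsExtensionMap ∅ μ :=
    { label_quant := fun n q v V hn => by
        obtain ⟨V', hV'⟩ := hq n q v V hn
        exact ⟨V', hV', by simp⟩
      label_conn := hc
      prec := hp
      branches := hb
      dependsOn := hd }
  exact h.embeds (fresh_of_forall (by simp) hU.2)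

/-- A tree that extends `T` encodes a hard problem if `T` does, for every notion of hardness that
is preserved when the first zero of a string is doubled. -/
theorem EncodesHard.of_extends {T U : PosTree} (hU : U.Regular) (hUT : U.Extends T)
    {H : Set (Set (List Bool))}
    (hH : ∀ A A', (∀ w, w ∈ A ↔ doubleFirstFalse w ∈ A') → A ∈ H → A' ∈ H)
    (hT : T.EncodesHard H) : U.EncodesHard H := by
  obtain ⟨τ, e, he, hs, hH'⟩ := hT
  obtain ⟨e', he', hs', htr⟩ := (Extends.embeds hU hUT).exists_isTranslation τ.inclusion
    τ.newConstant (Finset.disjoint_empty_left ∅) (E := []) (by simp) he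
    fun p => (hs p).trans Finset.subset_union_right
  refine ⟨τ.addConstant, e', he', fun p => by simpa using hs' p,
    hH _ _ (mem_modelChecking_iff_doubleFirstFalse fun n S => ?_) hH'⟩
  let _ := τ.inclusion.reduct (Fin (n + 1))
  -- With no variables in `D`, `Z` and `E`, both directions apply directly to the team of the empty
  -- assignment.
  have h := htr (Fin (n + 1))
  constructor
  · exact h.sat_right _ _ (by simp [Assignment.restrict_empty]) (by simp)
  · exact h.sat_left _ _ (by simp) (by simp [Assignment.extend_empty])

end PosTree

end IFLogic

theorem mainTheorem4 (T U : IFLogic.PosTree) (hU : U.Regular) (hUT : U.Extends T) :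
    (T.EncodesHard IFLogic.NLHard → U.EncodesHard IFLogic.NLHard) ∧
      (T.EncodesHard IFLogic.PHard → U.EncodesHard IFLogic.PHard) ∧
      (T.EncodesHard IFLogic.NPHard → U.EncodesHard IFLogic.NPHard) :=
  ⟨.of_extends hU hUT fun _ _ hA h B hB => (h B hB).doubleFirstFalse hA,
    .of_extends hU hUT fun _ _ hA h B hB => (h B hB).doubleFirstFalse hA,
    .of_extends hU hUT fun _ _ hA h B hB => (h B hB).doubleFirstFalse hA⟩
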